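/- **Definitions.** A coarse structure $\mathcal E$ on a set $X$ is a family of subsets of $X\times X$ that contains the diagonal and is closed under finite unions, compositions, inverses and subsets. It is connected if $\{(x,y)\}\in\mathcal E$ for all $x,y\in X$, and it has bounded geometry if for every $E\in\mathcal E$ the cardinalities of the slices $\{y:(y,x)\in E\}$ and $\{y:(x,y)\in E\}$ are bounded independently of $x$. The uniform Roe algebra $C^*_u(X;\mathcal E)\subseteq\mathcal B(\ell^2(X))$ is the norm closure of the $^*$-algebra of bounded operators $a$ whose support $\{(x,y):\langle\delta_x,a\delta_y\rangle\neq0\}$ belongs to $\mathcal E$; $\ell^\infty(X)$ acts on $\ell^2(X)$ by multiplication operators. A Cartan subalgebra of a $C^*$-algebra $A$ is a $C^*$-subalgebra $B$ such that $B$ is a maximal abelian self-adjoint subalgebra of $A$; $B$ contains an approximate unit for $A$; the normaliser $\mathcal N_A(B)=\{a\in A: aBa^*\cup a^*Ba\subseteq B\}$ generates $A$ as a $C^*$-algebra; and there is a faithful conditional expectation $A\to B$. Let $\mathcal X$ be the class of connected, bounded geometry coarse spaces $(X,\mathcal E)$. Let $\mathcal A$ be the class of triples $(A,B,\mathcal K)$,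 where $A$ is a unital $C^*$-algebra, $B\subseteq A$ is a Cartan subalgebra $^*$-isomorphic to $\ell^\infty(I)$ for some set $I$, and $\mathcal K$ is an essential ideal of $A$ that is $^*$-isomorphic to the compact operators on some Hilbert space. For $(A,B,\mathcal K)\in\mathcal A$ let $X_B$ be the set of minimal projections of $B$, and let $\mathcal E_A$ be the coarse structure on $X_B$ generated by the sets $$E_{a,\epsilon}=\{(p,q)\in X_B\times X_B:\|paq\|\ge\epsilon\},\qquad a\in\mathcal N_A(B),\ \epsilon>0.$$ Put $\Phi(X,\mathcal E)=(C^*_u(X;\mathcal E),\ell^\infty(X),\mathcal K(\ell^2(X)))$ and $\Psi(A,B,\mathcal K)=(X_B,\mathcal E_A)$. **Theorem.** 1. $\Phi$ is well defined: if $(X,\mathcal E)\in\mathcal X$, then $\ell^\infty(X)$ and $\mathcal K(\ell^2(X))$ are contained in $C^*_u(X;\mathcal E)$ and $\Phi(X,\mathcal E)\in\mathcal A$. 2. $\Psi$ is well defined: if $(A,B,\mathcal K)\in\mathcal A$, then $(X_B,\mathcal E_A)\in\mathcal X$. 3. $\Phi\circ\Psi$ is isomorphic to the identity: let $(A,B,\mathcal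 K)\in\mathcal A$. Then $\mathcal K$ has a faithful irreducible representation. Every faithful irreducible representation of $\mathcal K$ on a Hilbert space $H$ extends uniquely to a unital representation of $A$ on $H$; this extension is faithful and, identifying $A$ with its image, there is a unitary isomorphism $u:\ell^2(X_B)\to H$ such that $$u^*Au=C^*_u(X_B;\mathcal E_A),\qquad u^*Bu=\ell^\infty(X_B),\qquad u^*\mathcal Ku=\mathcal K(\ell^2(X_B)).$$ 4. $\Psi\circ\Phi$ is isomorphic to the identity: let $(X,\mathcal E)\in\mathcal X$ and $A=C^*_u(X;\mathcal E)$. Then sending $x$ to the orthogonal projection onto $\mathbb C\delta_x$ is a bijection from $X$ onto the set of minimal projections of $\ell^\infty(X)$, and under this identification $\mathcal E=\mathcal E_A$. (The empty coarse space and the zero triple are allowed; there, the zero representation on the zero Hilbert space counts as irreducible. Representations are taken to be nondegenerate.) -/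

import Mathlib

open scoped lp ENNReal

universe u w

/-! ### Coarse structures -/

/-- A coarse structure on the set `X`: a family of subsets of `X × X` (its entourages) that contains
the diagonal and is closed under finite unions, compositions, inverses and subsets. -/
structure CoarseStructure (X : Type u) where
  entourages : Set (SetRel X X)
  union_mem : ∀ E ∈ entourages, ∀ F ∈ entourages, E ∪ F ∈ entourages
  comp_mem : ∀ E ∈ entourages, ∀ F ∈ entourages, SetRel.comp E F ∈ entourages
  inv_mem : ∀ E ∈ entourages, SetRel.inv E ∈ entourages
  subset_mem : ∀ E ∈ entourages, ∀ F : SetRel X X, F ⊆ E → F ∈ entourages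
  diagonal_mem : SetRel.id ∈ entourages

namespace CoarseStructure

variable {X : Type u}

/-- The coarse structure generated by `S`: the intersection of all coarse structures
containing `S`. -/
def generate (S : Set (SetRel X X)) : CoarseStructure X where
  entourages := {E | ∀ D : CoarseStructure X, S ⊆ D.entourages → E ∈ D.entourages}
  union_mem E hE F hF D hD := D.union_mem E (hE D hD) F (hF D hD)
  comp_mem E hE F hF D hD := D.comp_mem E (hE D hD) F (hF D hD)
  inv_mem E hE D hD := D.inv_mem E (hE D hD)
  subset_mem E hE F hF D hD := D.subset_mem E (hE D hD) F hF
  diagonal_mem D _ := D.diagonal_mem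

/-- Every singleton `{(x, y)}` is an entourage. -/
def IsConnected (𝓔 : CoarseStructure X) : Prop :=
  ∀ x y : X, ({(x, y)} : SetRel X X) ∈ 𝓔.entourages

/-- For every entourage, the cardinalities of its rows and columns are uniformly bounded. -/
def HasBoundedGeometry (𝓔 : CoarseStructure X) : Prop :=
  ∀ E ∈ 𝓔.entourages, ∃ N : ℕ, ∀ x : X,
    {y : X | (y, x) ∈ E}.encard ≤ N ∧ {y : X | (x, y) ∈ E}.encard ≤ N

end CoarseStructure

/-! ### Compact operators -/

/-- The adjoint of a compact operator on a Hilbert space is compact. -/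
theorem isCompactOperator_star {H : Type u} [NormedAddCommGroup H] [InnerProductSpace ℂ H]
    [CompleteSpace H] (T : H →L[ℂ] H) (hT : IsCompactOperator T) :
    IsCompactOperator (star T : H →L[ℂ] H) := by
  have hTT : IsCompactOperator ((T * star T : H →L[ℂ] H) : H →ₗ[ℂ] H) := hT.comp_clm (star T)
  have htb : TotallyBounded ((T * star T : H →L[ℂ] H) '' Metric.closedBall 0 1) :=
    ((isCompactOperator_iff_isCompact_closure_image_closedBall
      ((T * star T : H →L[ℂ] H) : H →ₗ[ℂ] H) one_pos).1 hTT).totallyBounded.subset subset_closure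
  refine (isCompactOperator_iff_isCompact_closure_image_closedBall
      ((star T : H →L[ℂ] H) : H →ₗ[ℂ] H) one_pos).2 ?_
  refine TotallyBounded.isCompact_of_isClosed (TotallyBounded.closure ?_) isClosed_closure
  refine Metric.totallyBounded_iff.2 fun ε hε => ?_
  obtain ⟨t, hts, htf, hcov⟩ := htb.exists_subset (Metric.dist_mem_uniformity
    (show (0 : ℝ) < ε ^ 2 / 2 by positivity))
  obtain ⟨s, hs, hsf, rfl⟩ := Set.exists_subset_image_finite_and.1
    (show ∃ t' ⊆ (T * star T : H →L[ℂ] H) '' Metric.closedBall 0 1, t'.Finite ∧ t' = t from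
      ⟨t, hts, htf, rfl⟩)
  refine ⟨(star T : H →L[ℂ] H) '' s, hsf.image _, ?_⟩
  rintro _ ⟨x, hx, rfl⟩
  have hx' := hcov (Set.mem_image_of_mem _ hx)
  simp only [Set.mem_iUnion, Set.mem_ofPred_eq, Set.mem_image, exists_prop] at hx' ⊢
  obtain ⟨_, ⟨y, hy, rfl⟩, hxy⟩ := hx'
  refine ⟨_, ⟨y, hy, rfl⟩, ?_⟩
  have hy' := hs hy
  have hd : ‖x - y‖ ≤ 2 := by
    have h1 : ‖x‖ ≤ 1 := by simpa using hx
    have h2 : ‖y‖ ≤ 1 := by simpa using hy'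
    linarith [norm_sub_le x y]
  rw [dist_eq_norm, ← map_sub] at hxy
  have key : ‖(star T : H →L[ℂ] H) (x - y)‖ ^ 2 ≤ ‖(T * star T : H →L[ℂ] H) (x - y)‖ * ‖x - y‖ := by
    have h := ContinuousLinearMap.apply_norm_sq_eq_inner_adjoint_left
      (star T : H →L[ℂ] H) (x - y)
    rw [h, ContinuousLinearMap.star_eq_adjoint, ContinuousLinearMap.adjoint_adjoint]
    exact (Complex.re_le_norm _).trans (norm_inner_le_norm _ _)
  have : ‖(star T : H →L[ℂ] H) (x - y)‖ < ε := by
    refine lt_of_pow_lt_pow_left₀ 2 hε.le ?_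
    nlinarith [norm_nonneg ((T * star T : H →L[ℂ] H) (x - y))]
  simpa [dist_eq_norm, map_sub] using this

/-- The C⋆-algebra of compact operators on the Hilbert space `H`. -/
def compactOperators (H : Type u) [NormedAddCommGroup H] [InnerProductSpace ℂ H]
    [CompleteSpace H] : NonUnitalStarSubalgebra ℂ (H →L[ℂ] H) where
  carrier := {T | IsCompactOperator T}
  zero_mem' := isCompactOperator_zero
  add_mem' hS hT := hS.add hT
  smul_mem' c _ hT := hT.smul c
  mul_mem' {_ T} hS _ := hS.comp_clm T
  star_mem' {T} hT := isCompactOperator_star T hT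

/-! ### Operators on `ℓ²(X)` and the uniform Roe algebra -/

section Roe

variable {X : Type u}

open Classical in
/-- The canonical basis vector `δ_x` of `ℓ²(X)`. -/
noncomputable def delta (x : X) : ℓ²(X, ℂ) := lp.single 2 x 1

/-- The matrix entry `a_{xy} = ⟨δ_x, a δ_y⟩`. -/
noncomputable def matrixEntry (a : ℓ²(X, ℂ) →L[ℂ] ℓ²(X, ℂ)) (x y : X) : ℂ :=
  inner ℂ (delta x) (a (delta y))

/-- The support of an operator on `ℓ²(X)`. -/
def operatorSupport (a : ℓ²(X, ℂ) →L[ℂ] ℓ²(X, ℂ)) : SetRel X X :=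
  {p | matrixEntry a p.1 p.2 ≠ 0}

theorem inner_delta_left (x : X) (ξ : ℓ²(X, ℂ)) : inner ℂ (delta x) ξ = ξ x := by
  classical
  have h := lp.inner_single_left (𝕜 := ℂ) x (1 : ℂ) ξ
  simp only [delta]
  convert h using 1
  simp

theorem matrixEntry_star (a : ℓ²(X, ℂ) →L[ℂ] ℓ²(X, ℂ)) (x y : X) :
    matrixEntry (star a) x y = star (matrixEntry a y x) := by
  simp only [matrixEntry, ContinuousLinearMap.star_eq_adjoint]
  rw [ContinuousLinearMap.adjoint_inner_right, ← inner_conj_symm]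
  rfl

theorem exists_of_matrixEntry_mul_ne_zero (a b : ℓ²(X, ℂ) →L[ℂ] ℓ²(X, ℂ)) (x z : X)
    (h : matrixEntry (a * b) x z ≠ 0) :
    ∃ y, matrixEntry a x y ≠ 0 ∧ matrixEntry b y z ≠ 0 := by
  by_contra! hc
  apply h
  have h1 : matrixEntry (a * b) x z = inner ℂ (star a (delta x)) (b (delta z)) := by
    simp only [matrixEntry, ContinuousLinearMap.star_eq_adjoint]
    rw [ContinuousLinearMap.adjoint_inner_left]
    rfl
  rw [h1, lp.inner_eq_tsum]
  convert tsum_zero with y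
  have h2 : (star a (delta x)) y = star (matrixEntry a x y) := by
    rw [← matrixEntry_star, matrixEntry, inner_delta_left]
  have h3 : (b (delta z)) y = matrixEntry b y z := by
    rw [matrixEntry, inner_delta_left]
  rw [h2, h3]
  by_cases h4 : matrixEntry a x y = 0
  · simp [h4]
  · simp [hc y h4]

/-- The star algebra of operators of finite propagation, that is, with support in `𝓔`. -/
def finitePropagation (𝓔 : CoarseStructure X) :
    StarSubalgebra ℂ (ℓ²(X, ℂ) →L[ℂ] ℓ²(X, ℂ)) where
  carrier := {a | operatorSupport a ∈ 𝓔.entourages}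
  add_mem' {a b} ha hb := by
    refine 𝓔.subset_mem _ (𝓔.union_mem _ ha _ hb) _ fun p hp => ?_
    by_contra hc
    simp only [operatorSupport, Set.mem_union, Set.mem_ofPred_eq, not_or, not_not] at hc hp
    apply hp
    have : matrixEntry (a + b) p.1 p.2 = matrixEntry a p.1 p.2 + matrixEntry b p.1 p.2 :=
      inner_add_right _ _ _
    rw [this, hc.1, hc.2, add_zero]
  mul_mem' {a b} ha hb := by
    refine 𝓔.subset_mem _ (𝓔.comp_mem _ ha _ hb) _ fun p hp => ?_
    exact exists_of_matrixEntry_mul_ne_zero a b p.1 p.2 hp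
  star_mem' {a} ha := by
    refine 𝓔.subset_mem _ (𝓔.inv_mem _ ha) _ fun p hp => ?_
    have hp' : matrixEntry (star a) p.1 p.2 ≠ 0 := hp
    rw [matrixEntry_star] at hp'
    exact fun h => hp' (by rw [show matrixEntry a p.2 p.1 = 0 from h, star_zero])
  algebraMap_mem' c := by
    refine 𝓔.subset_mem _ 𝓔.diagonal_mem _ fun p hp => ?_
    classical
    by_contra hne
    apply hp
    have hne' : p.1 ≠ p.2 := hne
    have : matrixEntry (algebraMap ℂ (ℓ²(X, ℂ) →L[ℂ] ℓ²(X, ℂ)) c) p.1 p.2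
        = inner ℂ (delta p.1) (c • delta p.2) := rfl
    rw [this, inner_smul_right, inner_delta_left]
    simp [delta, hne']

/-- The uniform Roe algebra: the norm closure of the operators of finite propagation. -/
noncomputable def uniformRoeAlgebra (𝓔 : CoarseStructure X) :
    StarSubalgebra ℂ (ℓ²(X, ℂ) →L[ℂ] ℓ²(X, ℂ)) :=
  (finitePropagation 𝓔).topologicalClosure

instance uniformRoeAlgebra_isClosed (𝓔 : CoarseStructure X) :
    IsClosed (uniformRoeAlgebra 𝓔 : Set (ℓ²(X, ℂ) →L[ℂ] ℓ²(X, ℂ))) :=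
  StarSubalgebra.isClosed_topologicalClosure _

/-- `ℓ^∞(X)` acting on `ℓ²(X)` by multiplication operators. -/
def multiplicationOperators (X : Type u) :
    NonUnitalStarSubalgebra ℂ (ℓ²(X, ℂ) →L[ℂ] ℓ²(X, ℂ)) where
  carrier := {T | ∃ f : ℓ^∞(X, ℂ), ∀ (ξ : ℓ²(X, ℂ)) (x : X), T ξ x = f x * ξ x}
  zero_mem' := ⟨0, fun ξ x => by simp⟩
  add_mem' := by
    rintro S T ⟨f, hf⟩ ⟨g, hg⟩
    refine ⟨f + g, fun ξ x => ?_⟩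
    simp [hf, hg, add_mul]
  smul_mem' := by
    rintro c T ⟨f, hf⟩
    refine ⟨c • f, fun ξ x => ?_⟩
    simp [hf, mul_assoc]
  mul_mem' := by
    rintro S T ⟨f, hf⟩ ⟨g, hg⟩
    refine ⟨f * g, fun ξ x => ?_⟩
    simp [hf, hg, mul_assoc]
  star_mem' := by
    rintro T ⟨f, hf⟩
    refine ⟨star f, fun ξ x => ?_⟩
    have h1 : T (delta x) = f x • delta x := by
      ext y
      rw [hf]
      classical
      by_cases h : y = x
      · subst h; simp
      · simp [delta, h]
    rw [← inner_delta_left x, ContinuousLinearMap.star_eq_adjoint,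
      ContinuousLinearMap.adjoint_inner_right, h1, inner_smul_left, inner_delta_left]
    rfl

/-- `ℓ^∞(X)`, viewed inside the uniform Roe algebra. -/
noncomputable def ellInftyInRoe (𝓔 : CoarseStructure X) :
    NonUnitalStarSubalgebra ℂ (uniformRoeAlgebra 𝓔) :=
  (multiplicationOperators X).comap (uniformRoeAlgebra 𝓔).subtype

/-- `𝒦(ℓ²(X))`, viewed inside the uniform Roe algebra. -/
noncomputable def compactsInRoe (𝓔 : CoarseStructure X) :
    NonUnitalStarSubalgebra ℂ (uniformRoeAlgebra 𝓔) :=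
  (compactOperators ℓ²(X, ℂ)).comap (uniformRoeAlgebra 𝓔).subtype

end Roe

/-! ### Cartan subalgebras -/

section Cartan

/-- The normaliser `{a | a B a* ∪ a* B a ⊆ B}` of `B` in `A`. -/
def normaliser {A : Type u} [NonUnitalCStarAlgebra A] (B : NonUnitalStarSubalgebra ℂ A) : Set A :=
  {a | ∀ b ∈ B, a * b * star a ∈ B ∧ star a * b * a ∈ B}

/-- `E` is a faithful conditional expectation of `A` onto `B`: a positive contractive linear
projection onto `B` that is a `B`-bimodule map, and `E (a* a) = 0` only for `a = 0`.
Positive elements of `B` are written `b* b` with `b ∈ B`. -/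
structure IsFaithfulConditionalExpectation {A : Type u} [NonUnitalCStarAlgebra A]
    (B : NonUnitalStarSubalgebra ℂ A) (E : A →ₗ[ℂ] A) : Prop where
  map_mem : ∀ a, E a ∈ B
  map_of_mem : ∀ b ∈ B, E b = b
  norm_le : ∀ a, ‖E a‖ ≤ ‖a‖
  positive : ∀ a, ∃ b ∈ B, E (star a * a) = star b * b
  bimodule : ∀ a, ∀ b ∈ B, ∀ c ∈ B, E (b * a * c) = b * E a * c
  faithful : ∀ a, E (star a * a) = 0 → a = 0

/-- `B` is a Cartan subalgebra of the C⋆-algebra `A`. -/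
structure IsCartanSubalgebra {A : Type u} [NonUnitalCStarAlgebra A]
    (B : NonUnitalStarSubalgebra ℂ A) : Prop where
  isClosed : IsClosed (B : Set A)
  commutative : ∀ x ∈ B, ∀ y ∈ B, x * y = y * x
  maximal : ∀ C : NonUnitalStarSubalgebra ℂ A, (∀ x ∈ C, ∀ y ∈ C, x * y = y * x) → B ≤ C → C = B
  approximateUnit : ∃ l : Filter A, l.IsApproximateUnit ∧ (B : Set A) ∈ l
  generates : (NonUnitalStarAlgebra.adjoin ℂ (normaliser B)).topologicalClosure = ⊤
  expectation : ∃ E : A →ₗ[ℂ] A, IsFaithfulConditionalExpectation B E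

/-- `K` is an essential (closed, two-sided, self-adjoint) ideal of `A`. -/
structure IsEssentialIdeal {A : Type u} [NonUnitalCStarAlgebra A]
    (K : NonUnitalStarSubalgebra ℂ A) : Prop where
  isClosed : IsClosed (K : Set A)
  mul_mem_left : ∀ a : A, ∀ k ∈ K, a * k ∈ K
  mul_mem_right : ∀ a : A, ∀ k ∈ K, k * a ∈ K
  essential : ∀ a : A, (∀ k ∈ K, a * k = 0) → a = 0

/-- The triples `(A, B, K)`: `A` is a unital C⋆-algebra, `B` is a Cartan subalgebra of `A` that is
⋆-isomorphic to `ℓ^∞(I)` for some set `I`, and `K` is an essential ideal of `A` that is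
⋆-isomorphic to the compact operators on some Hilbert space. (It is no restriction that `I` and
the Hilbert space live in the universe of `A`: the minimal projections of `B`, and the elements
`k * p` of `K` for a minimal projection `p` of `K`, provide copies of them there.) -/
structure IsCartanTriple {A : Type u} [CStarAlgebra A]
    (B K : NonUnitalStarSubalgebra ℂ A) : Prop where
  cartan : IsCartanSubalgebra B
  ellInfty : ∃ I : Type u, Nonempty (B ≃⋆ₐ[ℂ] ℓ^∞(I, ℂ))
  essentialIdeal : IsEssentialIdeal K
  compacts : ∃ (H : Type u) (_ : NormedAddCommGroup H) (_ : InnerProductSpace ℂ H)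
    (_ : CompleteSpace H), Nonempty (K ≃⋆ₐ[ℂ] compactOperators H)

/-- The set of minimal projections of `B`: the nonzero projections `p ∈ B` with `p B p = ℂ p`. -/
def MinimalProjection {A : Type u} [NonUnitalCStarAlgebra A]
    (B : NonUnitalStarSubalgebra ℂ A) : Type u :=
  {p : A // p ∈ B ∧ IsStarProjection p ∧ p ≠ 0 ∧ ∀ b ∈ B, ∃ c : ℂ, p * b * p = c • p}

/-- The coarse structure `𝓔_A` on the set of minimal projections of `B`, generated by the sets
`E_{a,ε} = {(p, q) | ‖p a q‖ ≥ ε}`, for `a` in the normaliser of `B` and `ε > 0`. -/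
def cartanCoarseStructure {A : Type u} [NonUnitalCStarAlgebra A]
    (B : NonUnitalStarSubalgebra ℂ A) : CoarseStructure (MinimalProjection B) :=
  CoarseStructure.generate
    {E | ∃ a ∈ normaliser B, ∃ ε : ℝ, 0 < ε ∧ E = {p | ε ≤ ‖p.1.1 * a * p.2.1‖}}

end Cartan

/-! ### Representations -/

/-- A (nondegenerate) representation `π` of the star algebra `R` on the Hilbert space `H` is
irreducible: there is no closed invariant subspace other than `0` and `H`. -/
structure IsIrreducibleRep {R : Type u} [NonUnitalRing R] [StarRing R] [Module ℂ R]
    {H : Type w} [NormedAddCommGroup H] [InnerProductSpace ℂ H] [CompleteSpace H]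
    (π : R →⋆ₙₐ[ℂ] (H →L[ℂ] H)) : Prop where
  nondegenerate : ∀ ξ : H, (∀ r, π r ξ = 0) → ξ = 0
  irreducible : ∀ V : Submodule ℂ H, IsClosed (V : Set H) → (∀ r, ∀ ξ ∈ V, π r ξ ∈ V) →
    V = ⊥ ∨ V = ⊤

/-- Conjugation `T ↦ u* T u` of operators on `H` by a unitary isomorphism `u : ℓ²(X) → H`. -/
noncomputable def conjByUnitary {X : Type u} {H : Type w} [NormedAddCommGroup H]
    [InnerProductSpace ℂ H] (u : ℓ²(X, ℂ) ≃ₗᵢ[ℂ] H) (T : H →L[ℂ] H) :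
    ℓ²(X, ℂ) →L[ℂ] ℓ²(X, ℂ) :=
  (u.symm.toContinuousLinearEquiv : H →L[ℂ] ℓ²(X, ℂ)) ∘L T ∘L
    (u.toContinuousLinearEquiv : ℓ²(X, ℂ) →L[ℂ] H)

/-! Matrix entries with respect to the vectors `delta x` reduce both directions to graphs of partial
bijections. An operator supported on such a graph is a partial translation times a multiplication
operator, and it normalises `ℓ^∞(X)`.

For a coarse space, bounded geometry makes every entourage a finite union of such graphs
(`exists_isPartialBijection_cover_of_add_le`), so operators of finite propagation are finite sums of
normalisers. The diagonal part is a faithful conditional expectation, and the matrix units give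
maximality of `ℓ^∞(X)` and essentiality of the compacts. The coarse structure is recovered because
the partial translation along a graph has entries 1 there, while an element of the Roe algebra lies
within `ε` of an operator with support in `𝓔`, which cannot vanish at an entry of absolute value at
least `ε` (`mem_entourages_iff`).

For an abstract triple, a faithful irreducible representation of `K` is unitarily equivalent to the
identity representation of the compacts, so it maps `K` onto the compacts, and essentiality extends
it faithfully to `A`. Maximality of `B` makes its minimal projections minimal in `A`, hence of rank
one; faithfulness of the expectation makes their unit vectors a complete orthonormal system
(`exists_unitary_of_isCartanTriple`). In this basis `B` is the algebra of all multiplication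
operators, and a normaliser has at most one nonzero entry in each row and column. Dividing its large
entries by themselves shows that the generators of `𝓔_A` are graphs of partial translations lying in
`A`, which yields bounded geometry and places the Roe algebra inside `A`. Discarding its small
entries shows that it is a norm limit of operators of finite propagation, which places `A` inside
the Roe algebra. -/

section Operators

/-! ### Matrix entries, multiplication operators and partial translations -/

variable {X : Type u}

/-- Bounded operators on `ℓ²(X)`. -/
abbrev L2Op (X : Type u) : Type u := ℓ²(X, ℂ) →L[ℂ] ℓ²(X, ℂ)

theorem delta_apply_self (x : X) : (delta x : ℓ²(X, ℂ)) x = 1 := by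
  classical
  simp [delta]

theorem delta_apply_ne {x y : X} (h : y ≠ x) : (delta x : ℓ²(X, ℂ)) y = 0 := by
  classical
  simp [delta, h]

theorem inner_delta_delta_ne {x y : X} (h : x ≠ y) : inner ℂ (delta x) (delta y) = 0 := by
  rw [inner_delta_left, delta_apply_ne h]

theorem norm_delta (x : X) : ‖(delta x : ℓ²(X, ℂ))‖ = 1 := by
  classical
  simp [delta, lp.norm_single]

theorem delta_ne_zero (x : X) : (delta x : ℓ²(X, ℂ)) ≠ 0 := by
  rw [← norm_ne_zero_iff, norm_delta]
  exact one_ne_zero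

theorem orthonormal_delta : Orthonormal ℂ (delta : X → ℓ²(X, ℂ)) :=
  ⟨norm_delta, fun _ _ h => inner_delta_delta_ne h⟩

theorem norm_matrixEntry_le (a : L2Op X) (x y : X) : ‖matrixEntry a x y‖ ≤ ‖a‖ := by
  refine (norm_inner_le_norm _ _).trans ?_
  rw [norm_delta, one_mul]
  simpa [norm_delta] using a.le_opNorm (delta y)

theorem apply_delta_apply (a : L2Op X) (x y : X) : a (delta y) x = matrixEntry a x y := by
  rw [matrixEntry, inner_delta_left]

theorem ext_apply_delta {F : Type*} [AddCommGroup F] [Module ℂ F] [TopologicalSpace F] [T2Space F]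
    {a b : ℓ²(X, ℂ) →L[ℂ] F} (h : ∀ y, a (delta y) = b (delta y)) : a = b := by
  classical
  refine lp.ext_continuousLinearMap (p := 2) (by simp) fun y => ?_
  refine ContinuousLinearMap.ext_ring ?_
  simpa [delta] using h y

theorem ext_matrixEntry {a b : L2Op X} (h : ∀ x y, matrixEntry a x y = matrixEntry b x y) :
    a = b :=
  ext_apply_delta fun y => lp.ext (funext fun x => by
    rw [apply_delta_apply, apply_delta_apply, h])

theorem matrixEntry_add (a b : L2Op X) (x y : X) :
    matrixEntry (a + b) x y = matrixEntry a x y + matrixEntry b x y :=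
  inner_add_right _ _ _

theorem matrixEntry_sub (a b : L2Op X) (x y : X) :
    matrixEntry (a - b) x y = matrixEntry a x y - matrixEntry b x y :=
  inner_sub_right _ _ _

theorem matrixEntry_one_self (x : X) : matrixEntry (1 : L2Op X) x x = 1 := by
  rw [← apply_delta_apply]; exact delta_apply_self x

theorem matrixEntry_star_mul_self (a : L2Op X) (x : X) :
    matrixEntry (star a * a) x x = ((‖a (delta x)‖ ^ 2 : ℝ) : ℂ) := by
  have : matrixEntry (star a * a) x x = inner ℂ (delta x) (star a (a (delta x))) := rfl
  rw [this, ContinuousLinearMap.star_eq_adjoint, ContinuousLinearMap.adjoint_inner_right,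
    inner_self_eq_norm_sq_to_K]
  simp

theorem apply_delta_eq_smul {a : L2Op X} {x y : X} (h : ∀ z, z ≠ x → matrixEntry a z y = 0) :
    a (delta y) = matrixEntry a x y • delta x := by
  refine lp.ext (funext fun z => ?_)
  rw [apply_delta_apply, lp.coeFn_smul, Pi.smul_apply]
  by_cases hz : z = x
  · rw [hz, delta_apply_self, smul_eq_mul, mul_one]
  · rw [h z hz, delta_apply_ne hz, smul_zero]

/-! ### Multiplication operators -/

theorem norm_linfty_mul_apply_le (f : ℓ^∞(X, ℂ)) (ξ : ℓ²(X, ℂ)) (x : X) :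
    ‖f x * ξ x‖ ≤ ‖(((‖f‖ : ℂ) • ξ : ℓ²(X, ℂ)) : X → ℂ) x‖ := by
  rw [lp.coeFn_smul, Pi.smul_apply, smul_eq_mul, norm_mul, norm_mul]
  gcongr
  simpa using lp.norm_apply_le_norm (by simp) f x

/-- The operator of multiplication by a bounded function. -/
noncomputable def diagOp (f : ℓ^∞(X, ℂ)) : L2Op X :=
  LinearMap.mkContinuous
    { toFun := fun ξ => ⟨fun x => f x * ξ x,
        (lp.memℓp ((‖f‖ : ℂ) • ξ)).mono' (norm_linfty_mul_apply_le f ξ)⟩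
      map_add' := fun ξ η => lp.ext (funext fun x => mul_add _ _ _)
      map_smul' := fun c ξ => lp.ext (funext fun x => mul_left_comm _ _ _) }
    ‖f‖ fun ξ => by
      refine (lp.norm_mono (y := (‖f‖ : ℂ) • ξ) two_ne_zero (norm_linfty_mul_apply_le f ξ)).trans ?_
      rw [norm_smul]
      simp

theorem diagOp_apply (f : ℓ^∞(X, ℂ)) (ξ : ℓ²(X, ℂ)) (x : X) : diagOp f ξ x = f x * ξ x := rfl

theorem norm_diagOp_le (f : ℓ^∞(X, ℂ)) : ‖diagOp f‖ ≤ ‖f‖ :=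
  LinearMap.mkContinuous_norm_le _ (norm_nonneg _) _

theorem diagOp_mem (f : ℓ^∞(X, ℂ)) : diagOp f ∈ multiplicationOperators X :=
  ⟨f, fun _ _ => rfl⟩

/-- A bounded function as an element of `ℓ^∞`. -/
def boundedFun (f : X → ℂ) (C : ℝ) (h : ∀ x, ‖f x‖ ≤ C) : ℓ^∞(X, ℂ) :=
  ⟨f, memℓp_infty ⟨C, by rintro _ ⟨x, rfl⟩; exact h x⟩⟩

theorem diagOp_delta (f : ℓ^∞(X, ℂ)) (x : X) : diagOp f (delta x) = f x • delta x := by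
  refine lp.ext (funext fun y => ?_)
  rw [diagOp_apply, lp.coeFn_smul, Pi.smul_apply, smul_eq_mul]
  by_cases h : y = x
  · rw [h]
  · rw [delta_apply_ne h, mul_zero, mul_zero]

theorem eq_diagOp_of_apply_delta {a : L2Op X} {f : ℓ^∞(X, ℂ)}
    (h : ∀ x, a (delta x) = f x • delta x) : a = diagOp f :=
  ext_apply_delta fun x => by rw [h, diagOp_delta]

theorem matrixEntry_mul_diagOp (a : L2Op X) (f : ℓ^∞(X, ℂ)) (x y : X) :
    matrixEntry (a * diagOp f) x y = matrixEntry a x y * f y := by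
  rw [← apply_delta_apply, ← apply_delta_apply, ContinuousLinearMap.mul_def,
    ContinuousLinearMap.comp_apply, diagOp_delta, map_smul, lp.coeFn_smul, Pi.smul_apply,
    smul_eq_mul, mul_comm]

theorem matrixEntry_diagOp_mul (a : L2Op X) (f : ℓ^∞(X, ℂ)) (x y : X) :
    matrixEntry (diagOp f * a) x y = f x * matrixEntry a x y := by
  rw [← apply_delta_apply, ← apply_delta_apply, ContinuousLinearMap.mul_def,
    ContinuousLinearMap.comp_apply, diagOp_apply]

theorem mem_multiplicationOperators_iff {a : L2Op X} :
    a ∈ multiplicationOperators X ↔ ∃ f, a = diagOp f :=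
  ⟨fun ⟨f, hf⟩ => ⟨f, by ext ξ x; exact hf ξ x⟩, fun ⟨f, hf⟩ => hf ▸ diagOp_mem f⟩

theorem mem_multiplicationOperators_iff_matrixEntry {a : L2Op X} :
    a ∈ multiplicationOperators X ↔ ∀ x y, x ≠ y → matrixEntry a x y = 0 := by
  rw [mem_multiplicationOperators_iff]
  constructor
  · rintro ⟨f, rfl⟩ x y h
    rw [← apply_delta_apply, diagOp_apply, delta_apply_ne h, mul_zero]
  · intro h
    exact ⟨boundedFun (fun x => matrixEntry a x x) ‖a‖ fun x => norm_matrixEntry_le a x x,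
      eq_diagOp_of_apply_delta fun x => apply_delta_eq_smul fun z hz => h z x hz⟩

theorem matrixEntry_diagOp_self (f : ℓ^∞(X, ℂ)) (x : X) : matrixEntry (diagOp f) x x = f x := by
  rw [← apply_delta_apply, diagOp_apply, delta_apply_self, mul_one]

/-- The diagonal part of an operator. -/
noncomputable def diagPart (a : L2Op X) : L2Op X :=
  diagOp (boundedFun (fun x => matrixEntry a x x) ‖a‖ fun x => norm_matrixEntry_le a x x)

theorem matrixEntry_diagPart_self (a : L2Op X) (x : X) :
    matrixEntry (diagPart a) x x = matrixEntry a x x :=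
  matrixEntry_diagOp_self _ _

theorem diagPart_mem (a : L2Op X) : diagPart a ∈ multiplicationOperators X := diagOp_mem _

theorem norm_diagPart_le (a : L2Op X) : ‖diagPart a‖ ≤ ‖a‖ :=
  (norm_diagOp_le _).trans
    (lp.norm_le_of_forall_le (norm_nonneg _) fun x => norm_matrixEntry_le a x x)

theorem eq_of_mem_multiplicationOperators {a b : L2Op X} (ha : a ∈ multiplicationOperators X)
    (hb : b ∈ multiplicationOperators X) (h : ∀ x, matrixEntry a x x = matrixEntry b x x) :
    a = b := by
  rw [mem_multiplicationOperators_iff_matrixEntry] at ha hb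
  refine ext_matrixEntry fun x y => ?_
  by_cases hxy : x = y
  · rw [hxy, h]
  · rw [ha x y hxy, hb x y hxy]

/-! ### Partial translations -/

/-- The relation `R` is the graph of a partial bijection. -/
def IsPartialBijection (R : SetRel X X) : Prop :=
  (∀ x y z, (x, y) ∈ R → (x, z) ∈ R → y = z) ∧ ∀ x y z, (x, z) ∈ R → (y, z) ∈ R → x = y

/-- `v` is the partial isometry with matrix the indicator function of the graph `R` of a partial
bijection. -/
structure IsPartialTranslation (R : SetRel X X) (v : L2Op X) : Prop where
  isPartialBijection : IsPartialBijection R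
  entry_of_mem : ∀ x y, (x, y) ∈ R → matrixEntry v x y = 1
  entry_of_notMem : ∀ x y, (x, y) ∉ R → matrixEntry v x y = 0

theorem IsPartialBijection.inv {R : SetRel X X} (h : IsPartialBijection R) :
    IsPartialBijection (SetRel.inv R) :=
  ⟨fun x y z hy hz => h.2 y z x hy hz, fun x y z hx hy => h.1 z x y hx hy⟩

theorem IsPartialTranslation.apply_of_mem {R : SetRel X X} {v : L2Op X}
    (h : IsPartialTranslation R v) {x y : X} (hxy : (x, y) ∈ R) : v (delta y) = delta x := by
  rw [apply_delta_eq_smul (x := x) fun z hz => ?_, h.entry_of_mem x y hxy, one_smul]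
  exact h.entry_of_notMem z y fun hzy => hz (h.isPartialBijection.2 z x y hzy hxy)

theorem IsPartialTranslation.star {R : SetRel X X} {v : L2Op X} (h : IsPartialTranslation R v) :
    IsPartialTranslation (SetRel.inv R) (star v) where
  isPartialBijection := h.isPartialBijection.inv
  entry_of_mem x y hxy := by rw [matrixEntry_star, h.entry_of_mem y x hxy, star_one]
  entry_of_notMem x y hxy := by rw [matrixEntry_star, h.entry_of_notMem y x hxy, star_zero]

theorem IsPartialTranslation.mul {R S : SetRel X X} {v w : L2Op X} (hv : IsPartialTranslation R v)
    (hw : IsPartialTranslation S w) : IsPartialTranslation (SetRel.comp R S) (v * w) where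
  isPartialBijection := by
    refine ⟨?_, ?_⟩
    · rintro x y z ⟨a, hxa, hay⟩ ⟨b, hxb, hbz⟩
      obtain rfl := hv.isPartialBijection.1 x a b hxa hxb
      exact hw.isPartialBijection.1 a y z hay hbz
    · rintro x y z ⟨a, hxa, hay⟩ ⟨b, hxb, hbz⟩
      obtain rfl := hw.isPartialBijection.2 a b z hay hbz
      exact hv.isPartialBijection.2 x y a hxa hxb
  entry_of_mem := by
    rintro x z ⟨y, hxy, hyz⟩
    rw [← apply_delta_apply, ContinuousLinearMap.mul_def, ContinuousLinearMap.comp_apply,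
      hw.apply_of_mem hyz, hv.apply_of_mem hxy, delta_apply_self]
  entry_of_notMem x z hxz := by
    by_contra hne
    obtain ⟨y, hxy, hyz⟩ := exists_of_matrixEntry_mul_ne_zero v w x z hne
    exact hxz ⟨y, not_not.1 fun h => hxy (hv.entry_of_notMem x y h),
      not_not.1 fun h => hyz (hw.entry_of_notMem y z h)⟩

theorem isPartialTranslation_one : IsPartialTranslation (SetRel.id : SetRel X X) 1 where
  isPartialBijection := ⟨fun _ _ _ hy hz => Eq.trans (Eq.symm hy) hz,
    fun _ _ _ hx hy => Eq.trans hx (Eq.symm hy)⟩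
  entry_of_mem := by
    rintro x y rfl
    exact matrixEntry_one_self x
  entry_of_notMem x y hxy := by
    rw [← apply_delta_apply]
    exact delta_apply_ne hxy

/-- Take `v = V W*`, where the isometries `V, W : ℓ²(R) → ℓ²(X)` send `δ_r` to the basis vectors at
the first and second coordinate of `r`. Injectivity of the two coordinate projections on `R` is what
makes them isometries, and boundedness of `v` is then automatic. -/
theorem IsPartialBijection.exists_isPartialTranslation {R : SetRel X X}
    (hR : IsPartialBijection R) : ∃ v, IsPartialTranslation R v := by
  classical
  have h1 : Orthonormal ℂ fun r : R => (delta r.1.1 : ℓ²(X, ℂ)) :=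
    orthonormal_delta.comp (fun r : R => r.1.1) fun r s h =>
      Subtype.ext (Prod.ext h (hR.1 s.1.1 r.1.2 s.1.2 (by
        have := r.2; simp only at h; rw [← h]; exact this) s.2))
  have h2 : Orthonormal ℂ fun r : R => (delta r.1.2 : ℓ²(X, ℂ)) :=
    orthonormal_delta.comp (fun r : R => r.1.2) fun r s h =>
      Subtype.ext (Prod.ext (hR.2 r.1.1 s.1.1 s.1.2 (by
        have := r.2; simp only at h; rw [← h]; exact this) s.2) h)
  set V := h1.orthogonalFamily.linearIsometry
  set W := h2.orthogonalFamily.linearIsometry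
  have hV : ∀ r, V (delta r) = delta r.1.1 := fun r => by
    simp [V, delta, OrthogonalFamily.linearIsometry_apply_single]
  have hW : ∀ r, W (delta r) = delta r.1.2 := fun r => by
    simp [W, delta, OrthogonalFamily.linearIsometry_apply_single]
  set W' := ContinuousLinearMap.adjoint W.toContinuousLinearMap
  have hW' : ∀ y (r : R), W' (delta y) r = inner ℂ (delta r.1.2) (delta y) := fun y r => by
    rw [← inner_delta_left, ContinuousLinearMap.adjoint_inner_right]
    congr 1
    exact hW r
  have key : ∀ r : R, W' (delta r.1.2) = delta r := fun r => by
    refine lp.ext (funext fun s => ?_)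
    rw [hW', inner_delta_left]
    by_cases h : s = r
    · rw [h, delta_apply_self, delta_apply_self]
    · rw [delta_apply_ne h, delta_apply_ne]
      exact fun h' => h (h2.linearIndependent.injective (by simp [h']))
  refine ⟨V.toContinuousLinearMap ∘L W', hR, fun x y hxy => ?_, fun x y hxy => ?_⟩
  · rw [← apply_delta_apply]
    have := key ⟨(x, y), hxy⟩
    simp only at this
    rw [ContinuousLinearMap.comp_apply, this]
    exact (congrArg (fun ξ : ℓ²(X, ℂ) => ξ x) (hV _)).trans (delta_apply_self x)
  · rw [← apply_delta_apply, ContinuousLinearMap.comp_apply]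
    by_cases h : ∃ z, (z, y) ∈ R
    · obtain ⟨z, hz⟩ := h
      have := key ⟨(z, y), hz⟩
      simp only at this
      rw [this]
      refine (congrArg (fun ξ : ℓ²(X, ℂ) => ξ x) (hV _)).trans (delta_apply_ne ?_)
      rintro rfl
      exact hxy hz
    · have : W' (delta y) = 0 := by
        refine lp.ext (funext fun s => ?_)
        rw [hW', inner_delta_left, delta_apply_ne]
        · rfl
        · exact fun h' => h ⟨s.1.1, h' ▸ s.2⟩
      rw [this, map_zero]
      rfl

/-- An operator supported on the graph of a partial bijection is a partial translation times a
multiplication operator. -/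
theorem IsPartialTranslation.exists_restrict {R : SetRel X X} {v : L2Op X}
    (hv : IsPartialTranslation R v) (a : L2Op X) :
    ∃ f : ℓ^∞(X, ℂ), (∀ x y, (x, y) ∈ R → matrixEntry (v * diagOp f) x y = matrixEntry a x y) ∧
      ∀ x y, (x, y) ∉ R → matrixEntry (v * diagOp f) x y = 0 := by
  classical
  -- At `y` the function takes the entry of `a` over the only `x` with `(x, y) ∈ R`, and 0 if there
  -- is none; so it is bounded by `‖a‖`.
  refine ⟨boundedFun (fun y => if h : ∃ x, (x, y) ∈ R then matrixEntry a h.choose y else 0) ‖a‖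
    fun y => ?_, fun x y hxy => ?_, fun x y hxy => ?_⟩
  · split_ifs
    · exact norm_matrixEntry_le _ _ _
    · simp
  · rw [matrixEntry_mul_diagOp, hv.entry_of_mem x y hxy, one_mul]
    have h : ∃ x, (x, y) ∈ R := ⟨x, hxy⟩
    change dite _ _ _ = _
    rw [dif_pos h, hv.isPartialBijection.2 _ _ y h.choose_spec hxy]
  · rw [matrixEntry_mul_diagOp, hv.entry_of_notMem x y hxy, zero_mul]

theorem IsPartialTranslation.exists_eq_mul_diagOp {R : SetRel X X} {v : L2Op X}
    (hv : IsPartialTranslation R v) {a : L2Op X} (ha : operatorSupport a ⊆ R) :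
    ∃ f : ℓ^∞(X, ℂ), a = v * diagOp f := by
  obtain ⟨f, h1, h2⟩ := hv.exists_restrict a
  refine ⟨f, ext_matrixEntry fun x y => ?_⟩
  by_cases h : (x, y) ∈ R
  · rw [h1 x y h]
  · rw [h2 x y h]
    exact not_not.1 fun hne => h (ha hne)

/-- An operator supported on a finite union of graphs of partial bijections is a sum of operators
supported on these graphs. -/
theorem mem_of_operatorSupport_subset_sUnion {𝓡 : Set (SetRel X X)} (hfin : 𝓡.Finite)
    (h𝓡 : ∀ R ∈ 𝓡, IsPartialBijection R) (P : AddSubmonoid (L2Op X))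
    (hP : ∀ R ∈ 𝓡, ∀ a, operatorSupport a ⊆ R → a ∈ P) (a : L2Op X)
    (ha : operatorSupport a ⊆ ⋃₀ 𝓡) : a ∈ P := by
  induction 𝓡, hfin using Set.Finite.induction_on generalizing a with
  | empty =>
    have : a = 0 := ext_matrixEntry fun x y => by
      rw [show matrixEntry (0 : L2Op X) x y = 0 from inner_zero_right _]
      by_contra h
      simpa using ha (show (x, y) ∈ operatorSupport a from h)
    exact this ▸ P.zero_mem
  | @insert R 𝓡 _ _ ih =>
    obtain ⟨v, hv⟩ := (h𝓡 R (Set.mem_insert _ _)).exists_isPartialTranslation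
    obtain ⟨f, h1, h2⟩ := hv.exists_restrict a
    -- Split off the part of `a` on `R`; the remainder vanishes on `R`, so the other graphs cover
    -- its support.
    rw [← add_sub_cancel (v * diagOp f) a]
    refine P.add_mem (hP R (Set.mem_insert _ _) _ fun p hp => ?_)
      (ih (fun S hS => h𝓡 S (Set.mem_insert_of_mem _ hS))
        (fun S hS => hP S (Set.mem_insert_of_mem _ hS)) _ fun p hp => ?_)
    · exact not_not.1 fun h => hp (h2 _ _ h)
    · have hp' : matrixEntry (a - v * diagOp f) p.1 p.2 ≠ 0 := hp
      rw [matrixEntry_sub] at hp'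
      have hpR : p ∉ R := fun h => hp' (by rw [h1 _ _ h, sub_self])
      rw [h2 _ _ hpR, sub_zero] at hp'
      have := ha (show p ∈ operatorSupport a from hp')
      rw [Set.sUnion_insert] at this
      exact this.resolve_left hpR

end Operators

/-! ### Decomposing entourages into partial bijections -/

section Coarse

variable {X : Type u}

/-- Zorn's lemma: a pair of `E` sharing neither row nor column with `R` could be added to a maximal
`R`. -/
theorem exists_isPartialBijection_maximal (E : SetRel X X) :
    ∃ R ⊆ E, IsPartialBijection R ∧ ∀ x y, (x, y) ∈ E → (x, y) ∉ R →
      (∃ z, (x, z) ∈ R) ∨ ∃ z, (z, y) ∈ R := by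
  obtain ⟨R, hR⟩ := zorn_subset {R : SetRel X X | R ⊆ E ∧ IsPartialBijection R} (by
    intro c hc hchain
    refine ⟨⋃₀ c, ⟨Set.sUnion_subset fun R hR => (hc hR).1, ?_, ?_⟩,
      fun R hR => Set.subset_sUnion_of_mem hR⟩
    · rintro x y z ⟨R, hR, hxy⟩ ⟨S, hS, hxz⟩
      obtain h | h := hchain.total hR hS
      · exact (hc hS).2.1 x y z (h hxy) hxz
      · exact (hc hR).2.1 x y z hxy (h hxz)
    · rintro x y z ⟨R, hR, hxz⟩ ⟨S, hS, hyz⟩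
      obtain h | h := hchain.total hR hS
      · exact (hc hS).2.2 x y z (h hxz) hyz
      · exact (hc hR).2.2 x y z hxz (h hyz))
  refine ⟨R, hR.prop.1, hR.prop.2, fun x y hE hxy => ?_⟩
  by_contra! hc
  refine hxy (hR.le_of_ge (y := insert (x, y) R) ⟨Set.insert_subset hE hR.prop.1, ?_, ?_⟩
    (Set.subset_insert _ _) (Set.mem_insert _ _))
  · rintro a b c (hb | hb) (hc' | hc')
    · exact (Prod.ext_iff.1 hb).2.trans (Prod.ext_iff.1 hc').2.symm
    · obtain rfl : a = x := (Prod.ext_iff.1 hb).1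
      exact absurd hc' (hc.1 _)
    · obtain rfl : a = x := (Prod.ext_iff.1 hc').1
      exact absurd hb (hc.1 _)
    · exact hR.prop.2.1 a b c hb hc'
  · rintro a b c (hb | hb) (hc' | hc')
    · exact (Prod.ext_iff.1 hb).1.trans (Prod.ext_iff.1 hc').1.symm
    · obtain rfl : c = y := (Prod.ext_iff.1 hb).2
      exact absurd hc' (hc.2 _)
    · obtain rfl : c = y := (Prod.ext_iff.1 hc').2
      exact absurd hb (hc.2 _)
    · exact hR.prop.2.2 a b c hb hc'

/-- A greedy edge colouring. Removing a maximal partial bijection deletes another pair from the row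
or the column of every surviving pair, so the sum of the two slice sizes drops by at least one;
induct on a bound for this sum. -/
theorem exists_isPartialBijection_cover_of_add_le (n : ℕ) (E : SetRel X X)
    (hE : ∀ x y, (x, y) ∈ E → {z | (z, y) ∈ E}.encard + {z | (x, z) ∈ E}.encard ≤ n) :
    ∃ 𝓡 : Set (SetRel X X), 𝓡.Finite ∧ (∀ R ∈ 𝓡, IsPartialBijection R) ∧ E = ⋃₀ 𝓡 := by
  induction n generalizing E with
  | zero =>
    refine ⟨∅, Set.finite_empty, by simp, ?_⟩
    rw [Set.sUnion_empty, Set.eq_empty_iff_forall_notMem]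
    rintro ⟨x, y⟩ hxy
    have h := hE x y hxy
    rw [Nat.cast_zero, nonpos_iff_eq_zero, add_eq_zero, Set.encard_eq_zero] at h
    exact (Set.eq_empty_iff_forall_notMem.1 h.1 x) hxy
  | succ n ih =>
    obtain ⟨R, hRE, hR, hmax⟩ := exists_isPartialBijection_maximal E
    obtain ⟨𝓡, hfin, h𝓡, hU⟩ := ih (E \ R) (by
      rintro x y ⟨hxy, hxyR⟩
      have hle : ∀ {s t : Set X} {z : X}, s ⊆ t → z ∈ t → z ∉ s → s.encard + 1 ≤ t.encard := by
        intro s t z hst hz hzs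
        rw [← Set.encard_insert_of_notMem hzs]
        exact Set.encard_le_encard (Set.insert_subset hz hst)
      have h := hE x y hxy
      rw [Nat.cast_add, Nat.cast_one] at h
      have hs1 : {z | (z, y) ∈ E \ R} ⊆ {z | (z, y) ∈ E} := fun z hz => hz.1
      have hs2 : {z | (x, z) ∈ E \ R} ⊆ {z | (x, z) ∈ E} := fun z hz => hz.1
      refine (ENat.add_le_add_iff_right (k := 1) (by simp)).1 (le_trans ?_ h)
      obtain ⟨z, hz⟩ | ⟨z, hz⟩ := hmax x y hxy hxyR
      · rw [add_assoc]
        exact add_le_add (Set.encard_le_encard hs1)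
          (hle hs2 (show (x, z) ∈ E from hRE hz) fun h => h.2 hz)
      · rw [add_right_comm]
        exact add_le_add (hle hs1 (show (z, y) ∈ E from hRE hz) fun h => h.2 hz)
          (Set.encard_le_encard hs2))
    refine ⟨insert R 𝓡, hfin.insert R, ?_, ?_⟩
    · rintro S (rfl | hS)
      exacts [hR, h𝓡 S hS]
    · rw [Set.sUnion_insert, ← hU, Set.union_sdiff_cancel hRE]

/-- An entourage of a coarse space of bounded geometry is a finite union of graphs of partial
bijections. -/
theorem CoarseStructure.HasBoundedGeometry.exists_cover {𝓔 : CoarseStructure X}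
    (h : 𝓔.HasBoundedGeometry) {E : SetRel X X} (hE : E ∈ 𝓔.entourages) :
    ∃ 𝓡 : Set (SetRel X X), 𝓡.Finite ∧ (∀ R ∈ 𝓡, IsPartialBijection R) ∧ E = ⋃₀ 𝓡 := by
  obtain ⟨N, hN⟩ := h E hE
  refine exists_isPartialBijection_cover_of_add_le (N + N) E fun x y _ => ?_
  rw [Nat.cast_add]
  exact add_le_add (hN y).1 (hN x).2

theorem CoarseStructure.empty_mem (𝓔 : CoarseStructure X) : (∅ : SetRel X X) ∈ 𝓔.entourages :=
  𝓔.subset_mem _ 𝓔.diagonal_mem _ (Set.empty_subset _)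

theorem CoarseStructure.sUnion_mem (𝓔 : CoarseStructure X) {𝓡 : Set (SetRel X X)}
    (hfin : 𝓡.Finite) (h : ∀ R ∈ 𝓡, R ∈ 𝓔.entourages) : ⋃₀ 𝓡 ∈ 𝓔.entourages := by
  induction 𝓡, hfin using Set.Finite.induction_on with
  | empty => rw [Set.sUnion_empty]; exact 𝓔.empty_mem
  | @insert R 𝓡 _ _ ih =>
    rw [Set.sUnion_insert]
    exact 𝓔.union_mem _ (h R (Set.mem_insert _ _)) _
      (ih fun S hS => h S (Set.mem_insert_of_mem _ hS))

theorem CoarseStructure.mem_generate {S : Set (SetRel X X)} {E : SetRel X X} (hE : E ∈ S) :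
    E ∈ (CoarseStructure.generate S).entourages :=
  fun _ hD => hD hE

end Coarse

/-! ### Approximating compact operators by matrix units -/

section Compact

open InnerProductSpace

variable {X : Type u}

theorem rankOne_delta_delta_entry_of_ne (x y : X) {z t : X} (h : (z, t) ≠ (x, y)) :
    matrixEntry (rankOne ℂ (delta x) (delta y)) z t = 0 := by
  rw [matrixEntry, rankOne_apply, inner_smul_right]
  by_cases hz : z = x
  · subst hz
    have ht : y ≠ t := fun ht => h (by rw [ht])
    rw [inner_delta_delta_ne ht, zero_mul]
  · rw [inner_delta_delta_ne hz, mul_zero]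

theorem dense_span_delta :
    Dense (Submodule.span ℂ (Set.range (delta : X → ℓ²(X, ℂ))) : Set ℓ²(X, ℂ)) := by
  classical
  rw [dense_iff_closure_eq, Set.eq_univ_iff_forall]
  intro ξ
  refine mem_closure_of_tendsto (lp.hasSum_single (by simp) ξ) (Filter.Eventually.of_forall ?_)
  intro F
  refine Submodule.sum_mem _ fun x _ => ?_
  have : lp.single 2 x (ξ x) = ξ x • (delta x : ℓ²(X, ℂ)) := by
    rw [delta, ← lp.single_smul, smul_eq_mul, mul_one]
  exact this ▸ Submodule.smul_mem _ _ (Submodule.subset_span ⟨x, rfl⟩)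

/-- A compact operator is the limit of its compressions to finitely many rows. -/
theorem exists_finset_norm_sub_sum_le {a : L2Op X} (ha : IsCompactOperator a) {ε : ℝ}
    (hε : 0 < ε) :
    ∃ F : Finset X, ‖a - ∑ x ∈ F, rankOne ℂ (delta x) (star a (delta x))‖ ≤ ε := by
  classical
  have hrow : ∀ (F : Finset X) (ξ : ℓ²(X, ℂ)),
      (∑ x ∈ F, rankOne ℂ (delta x) (star a (delta x))) ξ
        = ∑ x ∈ F, lp.single 2 x ((a ξ) x) := by
    intro F ξ
    rw [sum_apply]
    refine Finset.sum_congr rfl fun x _ => ?_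
    rw [rankOne_apply, ContinuousLinearMap.star_eq_adjoint,
      ContinuousLinearMap.adjoint_inner_left, inner_delta_left, delta, ← lp.single_smul,
      smul_eq_mul, mul_one]
  have hproj : ∀ (F : Finset X) (η : ℓ²(X, ℂ)),
      ‖η - ∑ x ∈ F, lp.single 2 x (η x)‖ ≤ ‖η‖ := by
    intro F η
    refine lp.norm_mono two_ne_zero fun x => ?_
    rw [lp.coeFn_sub, Pi.sub_apply, lp.coeFn_sum, Finset.sum_apply]
    by_cases hx : x ∈ F
    · rw [Finset.sum_eq_single x (fun y _ hy => lp.single_apply_ne _ _ _ hy.symm)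
        (fun h => absurd hx h), lp.single_apply_self, sub_self, norm_zero]
      exact norm_nonneg _
    · have hne : ∀ y ∈ F, lp.single (E := fun _ => ℂ) 2 y (η y) x = 0 := fun y hy =>
        lp.single_apply_ne _ _ _ fun hxy => hx (hxy ▸ hy)
      rw [Finset.sum_eq_zero hne, sub_zero]
  -- The image of the unit ball has a finite `ε / 2`-net. Finitely many coordinates `F` determine
  -- every net point up to `ε / 2`.
  have htb : TotallyBounded (a '' Metric.closedBall 0 1) :=
    ((isCompactOperator_iff_isCompact_closure_image_closedBall (a : ℓ²(X, ℂ) →ₗ[ℂ] ℓ²(X, ℂ))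
      one_pos).1 ha).totallyBounded.subset subset_closure
  obtain ⟨t, ht, hcov⟩ := Metric.totallyBounded_iff.1 htb (ε / 2) (half_pos hε)
  have hev : ∀ᶠ F : Finset X in Filter.atTop, ∀ η ∈ t,
      ‖η - ∑ x ∈ F, lp.single 2 x (η x)‖ < ε / 2 := by
    rw [Filter.eventually_all_finite ht]
    intro η _
    have := Metric.tendsto_nhds.1 (lp.hasSum_single (by simp) η) (ε / 2) (half_pos hε)
    filter_upwards [this] with F hF
    rwa [dist_comm, dist_eq_norm] at hF
  obtain ⟨F, hF⟩ := hev.exists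
  refine ⟨F, ContinuousLinearMap.opNorm_le_of_unit_norm hε.le fun ξ hξ => ?_⟩
  have hmem := hcov (Set.mem_image_of_mem a (show ξ ∈ Metric.closedBall 0 1 by simp [hξ]))
  simp only [Set.mem_iUnion, exists_prop] at hmem
  obtain ⟨η, hη, hdist⟩ := hmem
  rw [Metric.mem_ball, dist_eq_norm] at hdist
  rw [sub_apply, hrow]
  -- Deleting the coordinates in `F` is a contraction, so replacing `a ξ` by a nearby net point
  -- costs at most another `ε / 2`.
  have hsplit : a ξ - ∑ x ∈ F, lp.single 2 x ((a ξ) x)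
      = ((a ξ - η) - ∑ x ∈ F, lp.single 2 x ((a ξ - η) x))
        + (η - ∑ x ∈ F, lp.single 2 x (η x)) := by
    simp only [lp.coeFn_sub, Pi.sub_apply, lp.single_sub, Finset.sum_sub_distrib]
    abel
  rw [hsplit]
  refine (norm_add_le _ _).trans ?_
  linarith [hproj F (a ξ - η), hF η hη]

/-- A closed space of operators which contains the matrix units contains the compact operators. -/
theorem compactOperators_subset_of_rankOne_mem (S : Submodule ℂ (L2Op X))
    (hS : IsClosed (S : Set (L2Op X)))
    (h : ∀ x y, rankOne ℂ (delta x) (delta y) ∈ S) (a : L2Op X)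
    (ha : a ∈ compactOperators ℓ²(X, ℂ)) : a ∈ S := by
  -- The admissible `η` form a closed subspace (`η` enters conjugate-linearly) which contains every
  -- `delta y`, whose span is dense.
  have hrow : ∀ x (η : ℓ²(X, ℂ)), rankOne ℂ (delta x) η ∈ S := by
    intro x
    have hcl : IsClosed {η : ℓ²(X, ℂ) | rankOne ℂ (delta x) η ∈ S} :=
      hS.preimage (rankOne ℂ (delta x)).continuous
    intro η
    refine hcl.closure_subset_iff.2 ?_ (dense_span_delta η)
    intro ζ hζ
    induction hζ using Submodule.span_induction with
    | mem ζ hζ =>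
      obtain ⟨y, rfl⟩ := hζ
      exact h x y
    | zero =>
      simp only [Set.mem_ofPred_eq, map_zero]
      exact S.zero_mem
    | add ζ ζ' _ _ h1 h2 =>
      simp only [Set.mem_ofPred_eq, map_add] at *
      exact S.add_mem h1 h2
    | smul c ζ _ h1 =>
      simp only [Set.mem_ofPred_eq, map_smulₛₗ] at *
      exact S.smul_mem _ h1
  refine hS.closure_subset_iff.2 subset_rfl (Metric.mem_closure_iff.2 fun ε hε => ?_)
  obtain ⟨F, hF⟩ := exists_finset_norm_sub_sum_le (a := a) ha (half_pos hε)
  refine ⟨_, S.sum_mem (t := F) fun x _ => hrow x (star a (delta x)), ?_⟩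
  rw [dist_eq_norm]
  exact hF.trans_lt (half_lt_self hε)

theorem isCompactOperator_rankOne {H : Type w} [NormedAddCommGroup H] [InnerProductSpace ℂ H]
    (ξ η : H) : IsCompactOperator (rankOne ℂ ξ η) := by
  have h : IsCompactOperator (ContinuousLinearMap.toSpanSingleton ℂ ξ) :=
    isCompactOperator_of_locallyCompactSpace_rng _
  exact h.comp_clm (innerSL ℂ η)

end Compact

/-! ### Normalisers and the diagonal expectation -/

section RoeCartan

open InnerProductSpace

variable {X : Type u}

/-- A nonzero entry at `(x, z)` needs a `y` with both `(x, y)` and `(z, y)` in `R`, and then `x =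
z`. -/
theorem mul_mul_star_mem_of_operatorSupport_subset {R : SetRel X X} (hR : IsPartialBijection R)
    {a d : L2Op X} (ha : operatorSupport a ⊆ R) (hd : d ∈ multiplicationOperators X) :
    a * d * star a ∈ multiplicationOperators X := by
  obtain ⟨f, rfl⟩ := mem_multiplicationOperators_iff.1 hd
  refine mem_multiplicationOperators_iff_matrixEntry.2 fun x z hxz => ?_
  by_contra hne
  obtain ⟨y, h1, h2⟩ := exists_of_matrixEntry_mul_ne_zero _ _ x z hne
  rw [matrixEntry_mul_diagOp] at h1
  rw [matrixEntry_star, star_ne_zero] at h2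
  exact hxz (hR.2 x z y (ha (left_ne_zero_of_mul h1)) (ha h2))

theorem operatorSupport_star_subset {R : SetRel X X} {a : L2Op X} (ha : operatorSupport a ⊆ R) :
    operatorSupport (star a) ⊆ SetRel.inv R := by
  intro p hp
  have hp' : matrixEntry (star a) p.1 p.2 ≠ 0 := hp
  rw [matrixEntry_star, star_ne_zero] at hp'
  exact ha (show (p.2, p.1) ∈ operatorSupport a from hp')

theorem star_mul_mul_mem_of_operatorSupport_subset {R : SetRel X X} (hR : IsPartialBijection R)
    {a d : L2Op X} (ha : operatorSupport a ⊆ R) (hd : d ∈ multiplicationOperators X) :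
    star a * d * a ∈ multiplicationOperators X := by
  simpa using mul_mul_star_mem_of_operatorSupport_subset hR.inv (operatorSupport_star_subset ha) hd

theorem operatorSupport_subset_id {a : L2Op X} (ha : a ∈ multiplicationOperators X) :
    operatorSupport a ⊆ SetRel.id := fun p hp =>
  not_not.1 fun h => hp (mem_multiplicationOperators_iff_matrixEntry.1 ha p.1 p.2 h)

variable {𝓔 : CoarseStructure X}

theorem mem_uniformRoeAlgebra_of_operatorSupport_mem {a : L2Op X}
    (ha : operatorSupport a ∈ 𝓔.entourages) : a ∈ uniformRoeAlgebra 𝓔 :=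
  StarSubalgebra.le_topologicalClosure _ (show a ∈ finitePropagation 𝓔 from ha)

theorem mem_uniformRoeAlgebra_of_mem_multiplicationOperators {a : L2Op X}
    (ha : a ∈ multiplicationOperators X) : a ∈ uniformRoeAlgebra 𝓔 :=
  mem_uniformRoeAlgebra_of_operatorSupport_mem
    (𝓔.subset_mem _ 𝓔.diagonal_mem _ (operatorSupport_subset_id ha))

theorem rankOne_delta_delta_mem_uniformRoeAlgebra (h : 𝓔.IsConnected) (x y : X) :
    rankOne ℂ (delta x) (delta y) ∈ uniformRoeAlgebra 𝓔 :=
  mem_uniformRoeAlgebra_of_operatorSupport_mem (𝓔.subset_mem _ (h x y) _ fun _ hp =>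
    not_not.1 fun hne => hp (rankOne_delta_delta_entry_of_ne x y hne))

theorem mem_uniformRoeAlgebra_of_mem_compactOperators (h : 𝓔.IsConnected) {a : L2Op X}
    (ha : a ∈ compactOperators ℓ²(X, ℂ)) : a ∈ uniformRoeAlgebra 𝓔 :=
  compactOperators_subset_of_rankOne_mem (Subalgebra.toSubmodule (uniformRoeAlgebra 𝓔).toSubalgebra)
    (uniformRoeAlgebra_isClosed 𝓔) (rankOne_delta_delta_mem_uniformRoeAlgebra h) a ha

theorem continuous_matrixEntry (x y : X) : Continuous fun a : L2Op X => matrixEntry a x y := by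
  unfold matrixEntry
  fun_prop

theorem isClosed_multiplicationOperators :
    IsClosed (multiplicationOperators X : Set (L2Op X)) := by
  have : (multiplicationOperators X : Set (L2Op X))
      = ⋂ (x) (y) (_ : x ≠ y), {a | matrixEntry a x y = 0} := by
    ext a
    simp only [SetLike.mem_coe, mem_multiplicationOperators_iff_matrixEntry, Set.mem_iInter,
      Set.mem_ofPred_eq]
  rw [this]
  exact isClosed_iInter fun x => isClosed_iInter fun y => isClosed_iInter fun _ =>
    isClosed_eq (continuous_matrixEntry x y) continuous_const

theorem isClosed_compactOperators {H : Type w} [NormedAddCommGroup H] [InnerProductSpace ℂ H]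
    [CompleteSpace H] : IsClosed (compactOperators H : Set (H →L[ℂ] H)) :=
  isClosed_setOfPred_isCompactOperator

theorem commute_of_mem_multiplicationOperators {a b : L2Op X}
    (ha : a ∈ multiplicationOperators X) (hb : b ∈ multiplicationOperators X) : a * b = b * a := by
  obtain ⟨f, rfl⟩ := mem_multiplicationOperators_iff.1 ha
  obtain ⟨g, rfl⟩ := mem_multiplicationOperators_iff.1 hb
  ext ξ x
  exact mul_left_comm _ _ _

theorem rankOne_delta_self_mem (x : X) :
    rankOne ℂ (delta x) (delta x) ∈ multiplicationOperators X :=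
  mem_multiplicationOperators_iff_matrixEntry.2 fun _ _ hyz =>
    rankOne_delta_delta_entry_of_ne x x fun h =>
      hyz ((Prod.ext_iff.1 h).1.trans (Prod.ext_iff.1 h).2.symm)

/-- An operator commuting with the projections onto the basis vectors is diagonal. -/
theorem mem_multiplicationOperators_of_commute {a : L2Op X}
    (h : ∀ x, a * rankOne ℂ (delta x) (delta x) = rankOne ℂ (delta x) (delta x) * a) :
    a ∈ multiplicationOperators X := by
  refine mem_multiplicationOperators_iff_matrixEntry.2 fun x y hxy => ?_
  have h1 := congrArg (fun b : L2Op X => b (delta y) x) (h y)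
  simp only [ContinuousLinearMap.mul_def, ContinuousLinearMap.comp_apply, rankOne_apply,
    inner_self_eq_norm_sq_to_K, norm_delta] at h1
  rw [map_smul, lp.coeFn_smul, lp.coeFn_smul, Pi.smul_apply, Pi.smul_apply, delta_apply_ne hxy,
    smul_zero, apply_delta_apply] at h1
  simpa using h1

/-- The diagonal part of an operator, as a linear map. -/
noncomputable def diagPartLinear (X : Type u) : L2Op X →ₗ[ℂ] L2Op X where
  toFun := diagPart
  map_add' a b := eq_of_mem_multiplicationOperators (diagPart_mem _)
    (add_mem (diagPart_mem _) (diagPart_mem _)) fun x => by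
      rw [matrixEntry_add]
      simp only [matrixEntry_diagPart_self]
      exact matrixEntry_add _ _ _ _
  map_smul' c a := eq_of_mem_multiplicationOperators (diagPart_mem _)
    (SMulMemClass.smul_mem c (diagPart_mem _)) fun x => by
      rw [matrixEntry_diagPart_self]
      refine (inner_smul_right _ _ _).trans (Eq.symm ((inner_smul_right _ _ _).trans ?_))
      exact congrArg (c * ·) (matrixEntry_diagPart_self _ _)

/-- The diagonal entries of `a* a` are `‖a δ_x‖ ^ 2`, so `b` is multiplication by `‖a δ_x‖`. -/
theorem exists_diagPart_star_mul_self (a : L2Op X) :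
    ∃ b ∈ multiplicationOperators X, diagPart (star a * a) = star b * b := by
  set f := boundedFun (fun x => ((‖a (delta x)‖ : ℝ) : ℂ)) ‖a‖ (fun x => by
    simpa [norm_delta] using a.le_opNorm (delta x)) with hf
  refine ⟨diagOp f, diagOp_mem f, ?_⟩
  refine eq_of_mem_multiplicationOperators (diagPart_mem _)
    (mul_mem (star_mem (diagOp_mem f)) (diagOp_mem f)) fun x => ?_
  rw [matrixEntry_diagPart_self, matrixEntry_star_mul_self, matrixEntry_star_mul_self,
    diagOp_delta, norm_smul, norm_delta, mul_one]
  simp [hf, boundedFun]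

theorem diagPart_bimodule (a : L2Op X) {b c : L2Op X} (hb : b ∈ multiplicationOperators X)
    (hc : c ∈ multiplicationOperators X) : diagPart (b * a * c) = b * diagPart a * c := by
  refine eq_of_mem_multiplicationOperators (diagPart_mem _)
    (mul_mem (mul_mem hb (diagPart_mem _)) hc) fun x => ?_
  obtain ⟨f, rfl⟩ := mem_multiplicationOperators_iff.1 hb
  obtain ⟨g, rfl⟩ := mem_multiplicationOperators_iff.1 hc
  simp only [matrixEntry_diagPart_self, matrixEntry_mul_diagOp, matrixEntry_diagOp_mul]

/-- The diagonal of `a* a` records the squared norms of the columns of `a`. -/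
theorem eq_zero_of_diagPart_star_mul_self {a : L2Op X} (ha : diagPart (star a * a) = 0) :
    a = 0 := by
  refine ext_apply_delta fun x => ?_
  have h1 : matrixEntry (star a * a) x x = 0 := by
    rw [← matrixEntry_diagPart_self, ha]
    exact inner_zero_right _
  rw [matrixEntry_star_mul_self] at h1
  simpa using h1

theorem eq_zero_of_mul_rankOne {a : L2Op X}
    (h : ∀ x, a * rankOne ℂ (delta x) (delta x) = 0) : a = 0 := by
  refine ext_apply_delta fun x => ?_
  have h1 := congrArg (fun b : L2Op X => b (delta x)) (h x)
  have h2 : a (rankOne ℂ (delta x) (delta x) (delta x)) = 0 := h1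
  rw [rankOne_apply, inner_self_eq_norm_sq_to_K, norm_delta] at h2
  simpa using h2

end RoeCartan

/-! ### The uniform Roe algebra as a Cartan triple -/

section Concrete

open InnerProductSpace

variable {X : Type u} {𝓔 : CoarseStructure X} {A : Type u} [CStarAlgebra A]

/-- `j` is a faithful representation of `A` on `ℓ²(X)` with image the uniform Roe algebra, which
takes `B` to the multiplication operators and `K` to the compact operators. -/
structure IsRoeRepresentation (𝓔 : CoarseStructure X) (B K : NonUnitalStarSubalgebra ℂ A)
    (j : A →⋆ₐ[ℂ] L2Op X) : Prop where
  injective : Function.Injective j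
  mem_range_iff : ∀ T, T ∈ uniformRoeAlgebra 𝓔 ↔ ∃ a, j a = T
  mem_left_iff : ∀ a, a ∈ B ↔ j a ∈ multiplicationOperators X
  mem_right_iff : ∀ a, a ∈ K ↔ j a ∈ compactOperators ℓ²(X, ℂ)

namespace IsRoeRepresentation

variable {B K : NonUnitalStarSubalgebra ℂ A} {j : A →⋆ₐ[ℂ] L2Op X}

theorem isometry (hj : IsRoeRepresentation 𝓔 B K j) : Isometry j :=
  NonUnitalStarAlgHom.isometry j hj.injective

theorem norm_map (hj : IsRoeRepresentation 𝓔 B K j) (a : A) : ‖j a‖ = ‖a‖ :=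
  NonUnitalStarAlgHom.norm_map j hj.injective a

theorem exists_left (hj : IsRoeRepresentation 𝓔 B K j) {T : L2Op X}
    (hT : T ∈ multiplicationOperators X) : ∃ a ∈ B, j a = T := by
  obtain ⟨a, rfl⟩ := (hj.mem_range_iff T).1
    (mem_uniformRoeAlgebra_of_mem_multiplicationOperators hT)
  exact ⟨a, (hj.mem_left_iff a).2 hT, rfl⟩

theorem exists_right (hj : IsRoeRepresentation 𝓔 B K j) (h : 𝓔.IsConnected) {T : L2Op X}
    (hT : T ∈ compactOperators ℓ²(X, ℂ)) : ∃ a ∈ K, j a = T := by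
  obtain ⟨a, rfl⟩ := (hj.mem_range_iff T).1 (mem_uniformRoeAlgebra_of_mem_compactOperators h hT)
  exact ⟨a, (hj.mem_right_iff a).2 hT, rfl⟩

theorem mem_normaliser (hj : IsRoeRepresentation 𝓔 B K j) {R : SetRel X X}
    (hR : IsPartialBijection R) {a : A} (ha : operatorSupport (j a) ⊆ R) : a ∈ normaliser B := by
  intro b hb
  rw [hj.mem_left_iff] at hb
  simp only [hj.mem_left_iff, map_mul, map_star]
  exact ⟨mul_mul_star_mem_of_operatorSupport_subset hR ha hb,
    star_mul_mul_mem_of_operatorSupport_subset hR ha hb⟩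

/-- An operator of finite propagation is a finite sum of operators supported on graphs of partial
bijections inside its entourage. The summands again belong to the Roe algebra and are normalisers,
so the dense subalgebra of finite propagation already lies in the algebra they generate, without
closure. -/
theorem adjoin_normaliser (hj : IsRoeRepresentation 𝓔 B K j) (h : 𝓔.HasBoundedGeometry) :
    (NonUnitalStarAlgebra.adjoin ℂ (normaliser B)).topologicalClosure = ⊤ := by
  set N := NonUnitalStarAlgebra.adjoin ℂ (normaliser B) with hN
  refine NonUnitalStarAlgebra.eq_top_iff.2 fun a => ?_
  have hfp : ∀ T : L2Op X, operatorSupport T ∈ 𝓔.entourages → ∃ c ∈ N, j c = T := by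
    intro T hT
    obtain ⟨𝓡, hfin, h𝓡, hU⟩ := h.exists_cover hT
    refine mem_of_operatorSupport_subset_sUnion hfin h𝓡
      (N.toNonUnitalSubalgebra.toSubmodule.toAddSubmonoid.map (j : A →+ L2Op X)) ?_ T hU.le
    intro R hR S hS
    obtain ⟨c, rfl⟩ := (hj.mem_range_iff S).1 (mem_uniformRoeAlgebra_of_operatorSupport_mem
      (𝓔.subset_mem _ hT _ (hS.trans (hU ▸ Set.subset_sUnion_of_mem hR))))
    exact ⟨c, NonUnitalStarAlgebra.subset_adjoin ℂ _ (hj.mem_normaliser (h𝓡 R hR) hS), rfl⟩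
  change a ∈ closure (N : Set A)
  refine Metric.mem_closure_iff.2 fun ε hε => ?_
  have ha : j a ∈ closure (finitePropagation 𝓔 : Set (L2Op X)) := (hj.mem_range_iff _).2 ⟨a, rfl⟩
  obtain ⟨T, hT, haT⟩ := Metric.mem_closure_iff.1 ha ε hε
  obtain ⟨c, hc, rfl⟩ := hfp T hT
  exact ⟨c, hc, by rwa [hj.isometry.dist_eq] at haT⟩

theorem exists_expectation (hj : IsRoeRepresentation 𝓔 B K j) :
    ∃ E : A →ₗ[ℂ] A, IsFaithfulConditionalExpectation B E := by
  choose E hEB hE using fun a => hj.exists_left (diagPart_mem (j a))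
  refine ⟨
    { toFun := E
      map_add' := fun a b => hj.injective (by
        rw [map_add, hE, hE, hE, map_add]
        exact map_add (diagPartLinear X) _ _)
      map_smul' := fun c a => hj.injective (by
        rw [RingHom.id_apply, map_smul, hE, hE, map_smul]
        exact map_smul (diagPartLinear X) _ _) },
    ⟨hEB, fun b hb => hj.injective ?_, fun a => ?_, fun a => ?_, fun a b hb c hc => ?_,
      fun a ha => ?_⟩⟩
  · exact (hE b).trans (eq_of_mem_multiplicationOperators (diagPart_mem _)
      ((hj.mem_left_iff b).1 hb) fun x => matrixEntry_diagPart_self _ _)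
  · rw [← hj.norm_map, ← hj.norm_map a]
    exact (congrArg norm (hE a)).trans_le (norm_diagPart_le _)
  · obtain ⟨S, hS, h⟩ := exists_diagPart_star_mul_self (j a)
    obtain ⟨b, hb, rfl⟩ := hj.exists_left hS
    refine ⟨b, hb, hj.injective ((hE _).trans ?_)⟩
    rw [map_mul, map_star, h, map_mul, map_star]
  · refine hj.injective ((hE _).trans ?_)
    rw [map_mul, map_mul, diagPart_bimodule _ ((hj.mem_left_iff b).1 hb)
      ((hj.mem_left_iff c).1 hc), map_mul, map_mul]
    exact congrArg (fun T => j b * T * j c) (hE a).symm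
  · refine hj.injective ?_
    rw [map_zero]
    refine eq_zero_of_diagPart_star_mul_self ?_
    rw [← map_star, ← map_mul, ← hE]
    exact (congrArg j ha).trans (map_zero j)

theorem isCartanSubalgebra (hj : IsRoeRepresentation 𝓔 B K j) (h' : 𝓔.HasBoundedGeometry) :
    IsCartanSubalgebra B where
  isClosed := by
    have : (B : Set A) = j ⁻¹' multiplicationOperators X := Set.ext hj.mem_left_iff
    rw [this]
    exact isClosed_multiplicationOperators.preimage hj.isometry.continuous
  commutative x hx y hy := hj.injective (by
    rw [map_mul, map_mul]
    exact commute_of_mem_multiplicationOperators ((hj.mem_left_iff x).1 hx)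
      ((hj.mem_left_iff y).1 hy))
  -- An element of `C` commutes with the projections onto all `ℂ δ_x`, which lie in `B`, so it is
  -- diagonal.
  maximal C hC hle := le_antisymm (fun a ha => (hj.mem_left_iff a).2
    (mem_multiplicationOperators_of_commute fun x => by
      obtain ⟨b, hb, hbx⟩ := hj.exists_left (rankOne_delta_self_mem x)
      rw [← hbx, ← map_mul, ← map_mul, hC a ha b (hle hb)])) hle
  approximateUnit := ⟨pure 1, .pure_one A, (hj.mem_left_iff 1).2 (by
    rw [map_one]
    exact mem_multiplicationOperators_iff_matrixEntry.2 fun _ _ hxy => inner_delta_delta_ne hxy)⟩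
  generates := hj.adjoin_normaliser h'
  expectation := hj.exists_expectation

theorem nonempty_left_equiv (hj : IsRoeRepresentation 𝓔 B K j) :
    Nonempty (B ≃⋆ₐ[ℂ] ℓ^∞(X, ℂ)) := by
  choose g hgB hg using fun f : ℓ^∞(X, ℂ) => hj.exists_left (diagOp_mem f)
  refine ⟨StarAlgEquiv.symm
    { toFun := fun f => ⟨g f, hgB f⟩
      invFun := fun a => (mem_multiplicationOperators_iff.1 ((hj.mem_left_iff _).1 a.2)).choose
      left_inv := fun f => lp.ext (funext fun x => ?_)
      right_inv := fun a => Subtype.ext (hj.injective ?_)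
      map_mul' := fun f h => Subtype.ext (hj.injective ?_)
      map_add' := fun f h => Subtype.ext (hj.injective ?_)
      map_star' := fun f => Subtype.ext (hj.injective ?_)
      map_smul' := fun c f => Subtype.ext (hj.injective ?_) }⟩
  · have h := (mem_multiplicationOperators_iff.1 ((hj.mem_left_iff _).1 (hgB f))).choose_spec
    replace h := (hg f).symm.trans h
    rw [← matrixEntry_diagOp_self f, ← matrixEntry_diagOp_self]
    exact congrArg (fun T => matrixEntry T x x) h.symm
  · rw [hg]
    exact (mem_multiplicationOperators_iff.1 ((hj.mem_left_iff _).1 a.2)).choose_spec.symm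
  · change j (g (f * h)) = j (g f * g h)
    rw [map_mul, hg, hg, hg]
    ext ξ x
    exact mul_assoc _ _ _
  · change j (g (f + h)) = j (g f + g h)
    rw [map_add, hg, hg, hg]
    ext ξ x
    exact add_mul _ _ _
  · change j (g (star f)) = j (star (g f))
    rw [map_star, hg, hg]
    refine eq_of_mem_multiplicationOperators (diagOp_mem _) (star_mem (diagOp_mem _)) fun x => ?_
    rw [matrixEntry_diagOp_self, matrixEntry_star, matrixEntry_diagOp_self]
    rfl
  · change j (g (c • f)) = j (c • g f)
    rw [map_smul, hg, hg]
    ext ξ x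
    exact mul_assoc _ _ _

theorem nonempty_right_equiv (hj : IsRoeRepresentation 𝓔 B K j) (h : 𝓔.IsConnected) :
    Nonempty (K ≃⋆ₐ[ℂ] compactOperators ℓ²(X, ℂ)) := by
  choose g hgK hg using fun T : compactOperators ℓ²(X, ℂ) => hj.exists_right h T.2
  exact ⟨
    { toFun := fun a => ⟨j a, (hj.mem_right_iff _).1 a.2⟩
      invFun := fun T => ⟨g T, hgK T⟩
      left_inv := fun a => Subtype.ext (hj.injective (hg _))
      right_inv := fun T => Subtype.ext (hg T)
      map_mul' := fun a b => Subtype.ext (map_mul j a.1 b.1)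
      map_add' := fun a b => Subtype.ext (map_add j a.1 b.1)
      map_star' := fun a => Subtype.ext (map_star j a.1)
      map_smul' := fun c a => Subtype.ext (map_smul j c a.1) }⟩

theorem isEssentialIdeal (hj : IsRoeRepresentation 𝓔 B K j) (h : 𝓔.IsConnected) :
    IsEssentialIdeal K where
  isClosed := by
    have : (K : Set A) = j ⁻¹' compactOperators ℓ²(X, ℂ) := Set.ext hj.mem_right_iff
    rw [this]
    exact isClosed_compactOperators.preimage hj.isometry.continuous
  mul_mem_left a k hk := by
    rw [hj.mem_right_iff, map_mul]
    exact IsCompactOperator.clm_comp ((hj.mem_right_iff k).1 hk) (j a)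
  mul_mem_right a k hk := by
    rw [hj.mem_right_iff, map_mul]
    exact IsCompactOperator.comp_clm ((hj.mem_right_iff k).1 hk) (j a)
  essential a ha := by
    refine hj.injective ?_
    rw [map_zero]
    refine eq_zero_of_mul_rankOne fun x => ?_
    obtain ⟨k, hk, hkx⟩ := hj.exists_right h (T := rankOne ℂ (delta x) (delta x))
      (isCompactOperator_rankOne _ _)
    rw [← hkx, ← map_mul, ha k hk, map_zero]

theorem isCartanTriple (hj : IsRoeRepresentation 𝓔 B K j) (h : 𝓔.IsConnected)
    (h' : 𝓔.HasBoundedGeometry) : IsCartanTriple B K where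
  cartan := hj.isCartanSubalgebra h'
  ellInfty := ⟨X, hj.nonempty_left_equiv⟩
  essentialIdeal := hj.isEssentialIdeal h
  compacts := ⟨_, _, _, inferInstance, hj.nonempty_right_equiv h⟩

end IsRoeRepresentation

theorem isRoeRepresentation_subtype (𝓔 : CoarseStructure X) :
    IsRoeRepresentation 𝓔 (ellInftyInRoe 𝓔) (compactsInRoe 𝓔) (uniformRoeAlgebra 𝓔).subtype where
  injective := Subtype.val_injective
  mem_range_iff T := ⟨fun hT => ⟨⟨T, hT⟩, rfl⟩, fun ⟨a, ha⟩ => ha ▸ a.2⟩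
  mem_left_iff _ := Iff.rfl
  mem_right_iff _ := Iff.rfl

theorem isCartanTriple_roe (h : 𝓔.IsConnected) (h' : 𝓔.HasBoundedGeometry) :
    IsCartanTriple (ellInftyInRoe 𝓔) (compactsInRoe 𝓔) :=
  (isRoeRepresentation_subtype 𝓔).isCartanTriple h h'

end Concrete

/-! ### Recovering the coarse space from its Roe algebra -/

section Minimal

open InnerProductSpace

variable {X : Type u}

theorem rankOne_mul_mul_rankOne (T : L2Op X) (x y : X) :
    rankOne ℂ (delta x) (delta x) * T * rankOne ℂ (delta y) (delta y)
      = matrixEntry T x y • rankOne ℂ (delta x) (delta y) := by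
  ext1 ξ
  change rankOne ℂ (delta x) (delta x) (T (rankOne ℂ (delta y) (delta y) ξ))
    = matrixEntry T x y • rankOne ℂ (delta x) (delta y) ξ
  rw [rankOne_apply, rankOne_apply, rankOne_apply, map_smul, inner_smul_right, smul_smul, mul_comm]
  rfl

theorem norm_rankOne_mul_mul_rankOne (T : L2Op X) (x y : X) :
    ‖rankOne ℂ (delta x) (delta x) * T * rankOne ℂ (delta y) (delta y)‖ = ‖matrixEntry T x y‖ := by
  rw [rankOne_mul_mul_rankOne, norm_smul, norm_rankOne, norm_delta, norm_delta, mul_one, mul_one]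

theorem diagOp_mul_rankOne (f : ℓ^∞(X, ℂ)) (x : X) :
    diagOp f * rankOne ℂ (delta x) (delta x) = f x • rankOne ℂ (delta x) (delta x) := by
  ext1 ξ
  change diagOp f (rankOne ℂ (delta x) (delta x) ξ) = f x • rankOne ℂ (delta x) (delta x) ξ
  rw [rankOne_apply, map_smul, diagOp_delta, smul_comm]

theorem rankOne_mul_diagOp (f : ℓ^∞(X, ℂ)) (x : X) :
    rankOne ℂ (delta x) (delta x) * diagOp f = f x • rankOne ℂ (delta x) (delta x) := by
  rw [← commute_of_mem_multiplicationOperators (diagOp_mem f) (rankOne_delta_self_mem x),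
    diagOp_mul_rankOne]

theorem isStarProjection_rankOne_delta (x : X) :
    IsStarProjection (rankOne ℂ (delta x) (delta x) : L2Op X) :=
  isStarProjection_rankOne_self (norm_delta x)

theorem rankOne_delta_ne_zero (x y : X) : (rankOne ℂ (delta x) (delta y) : L2Op X) ≠ 0 := by
  rw [← norm_ne_zero_iff, norm_rankOne, norm_delta, norm_delta, mul_one]
  exact one_ne_zero

theorem rankOne_delta_injective {x y : X}
    (h : (rankOne ℂ (delta x) (delta x) : L2Op X) = rankOne ℂ (delta y) (delta y)) : x = y := by
  by_contra hne
  have h1 := congrArg (fun T : L2Op X => T (delta x)) h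
  simp only [rankOne_apply] at h1
  rw [inner_delta_delta_ne (Ne.symm hne), zero_smul, inner_delta_left, delta_apply_self,
    one_smul] at h1
  exact delta_ne_zero x h1

/-- Transport of a coarse structure along a bijection. -/
def CoarseStructure.mapEquiv {Y : Type w} (𝓔 : CoarseStructure X) (e : X ≃ Y) :
    CoarseStructure Y where
  entourages := {F | Prod.map e e ⁻¹' F ∈ 𝓔.entourages}
  union_mem E hE F hF := 𝓔.union_mem _ hE _ hF
  comp_mem E hE F hF := by
    refine 𝓔.subset_mem _ (𝓔.comp_mem _ hE _ hF) _ ?_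
    rintro ⟨x, z⟩ ⟨y, hxy, hyz⟩
    refine ⟨e.symm y, ?_, ?_⟩
    · rwa [Set.mem_preimage, Prod.map_apply, e.apply_symm_apply]
    · rwa [Set.mem_preimage, Prod.map_apply, e.apply_symm_apply]
  inv_mem E hE := 𝓔.inv_mem _ hE
  subset_mem E hE F hFE := 𝓔.subset_mem _ hE _ (Set.preimage_mono hFE)
  diagonal_mem := 𝓔.subset_mem _ 𝓔.diagonal_mem _ fun _ hp => e.injective hp

variable {𝓔 : CoarseStructure X} {A : Type u} [CStarAlgebra A]
  {B K : NonUnitalStarSubalgebra ℂ A} {j : A →⋆ₐ[ℂ] L2Op X}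

namespace IsRoeRepresentation

/-- A minimal projection `q` is multiplication by some `f`, and idempotency gives `f x = 1` at a
point where `f` does not vanish. Compressing the projection onto `ℂ δ_x` by `q` returns it
unchanged, while minimality makes the result a multiple of `q`; so the two coincide. -/
theorem exists_equiv_minimalProjection (hj : IsRoeRepresentation 𝓔 B K j) :
    ∃ e : X ≃ MinimalProjection B, ∀ x, j (e x).1 = rankOne ℂ (delta x) (delta x) := by
  choose p hpB hp using fun x : X => hj.exists_left (rankOne_delta_self_mem x)
  have hmin : ∀ x, IsStarProjection (p x) ∧ p x ≠ 0 ∧ ∀ b ∈ B, ∃ c : ℂ, p x * b * p x = c • p x := by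
    intro x
    refine ⟨⟨hj.injective ?_, hj.injective ?_⟩, fun h => ?_, fun b hb => ?_⟩
    · rw [map_mul, hp]
      exact (isStarProjection_rankOne_delta x).isIdempotentElem
    · rw [map_star, hp]
      exact (isStarProjection_rankOne_delta x).isSelfAdjoint
    · have := hp x
      rw [h, map_zero] at this
      exact rankOne_delta_ne_zero x x this.symm
    · refine ⟨matrixEntry (j b) x x, hj.injective ?_⟩
      rw [map_mul, map_mul, map_smul, hp, rankOne_mul_mul_rankOne]
  refine ⟨Equiv.ofBijective (fun x => ⟨p x, hpB x, hmin x⟩) ⟨fun x y hxy => ?_, fun q => ?_⟩, hp⟩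
  · refine rankOne_delta_injective ?_
    rw [← hp, ← hp]
    exact congrArg j (Subtype.ext_iff.1 hxy)
  · obtain ⟨q, hqB, hq, hq0, hqmin⟩ := q
    obtain ⟨f, hf⟩ := mem_multiplicationOperators_iff.1 ((hj.mem_left_iff q).1 hqB)
    obtain ⟨x, hx⟩ : ∃ x, f x ≠ 0 := by
      by_contra! h
      refine hq0 (hj.injective ?_)
      rw [hf, map_zero]
      refine ext_apply_delta fun x => ?_
      rw [diagOp_delta, h, zero_smul]
      rfl
    have hfx : f x * f x = f x := by
      have h := congrArg (fun T => matrixEntry T x x) (congrArg j hq.isIdempotentElem)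
      simpa only [map_mul, hf, matrixEntry_mul_diagOp, matrixEntry_diagOp_self] using h
    have hfx1 : f x = 1 := mul_left_cancel₀ hx (hfx.trans (mul_one _).symm)
    obtain ⟨c, hc⟩ := hqmin (p x) (hpB x)
    have h1 : rankOne ℂ (delta x) (delta x) = c • diagOp f := by
      have h := congrArg j hc
      rw [map_mul, map_mul, map_smul, hp, hf, diagOp_mul_rankOne, smul_mul_assoc,
        rankOne_mul_diagOp, hfx1, one_smul, one_smul] at h
      exact h
    have hc1 : c = 1 := by
      have h := congrArg (fun T : L2Op X => T (delta x) x) h1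
      have h' : (rankOne ℂ (delta x) (delta x) (delta x) : ℓ²(X, ℂ)) x
        = c * diagOp f (delta x) x := h
      rw [rankOne_apply, inner_delta_left, delta_apply_self, one_smul, delta_apply_self,
        diagOp_apply, hfx1, delta_apply_self, mul_one, mul_one] at h'
      exact h'.symm
    refine ⟨x, Subtype.ext (hj.injective ?_)⟩
    change j (p x) = j q
    rw [hp, hf, h1, hc1, one_smul]

theorem norm_mul_mul (hj : IsRoeRepresentation 𝓔 B K j) {e : X ≃ MinimalProjection B}
    (he : ∀ x, j (e x).1 = rankOne ℂ (delta x) (delta x)) (a : A) (x y : X) :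
    ‖(e x).1 * a * (e y).1‖ = ‖matrixEntry (j a) x y‖ := by
  rw [← hj.norm_map, map_mul, map_mul, he, he, norm_rankOne_mul_mul_rankOne]

/-- Forwards, each graph in the decomposition of `E` lies in the generator given by its partial
translation and `ε = 1`. Backwards, approximate `a` within `ε` by an operator `T` of finite
propagation: wherever an entry of `a` has absolute value at least `ε`, the entry of `T` is nonzero.
-/
theorem mem_entourages_iff (hj : IsRoeRepresentation 𝓔 B K j) (h' : 𝓔.HasBoundedGeometry)
    {e : X ≃ MinimalProjection B} (he : ∀ x, j (e x).1 = rankOne ℂ (delta x) (delta x))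
    (E : SetRel X X) :
    E ∈ 𝓔.entourages ↔ Prod.map e e '' E ∈ (cartanCoarseStructure B).entourages := by
  constructor
  · intro hE
    obtain ⟨𝓡, hfin, h𝓡, rfl⟩ := h'.exists_cover hE
    rw [Set.sUnion_eq_biUnion, Set.image_iUnion₂, ← Set.sUnion_image]
    refine CoarseStructure.sUnion_mem _ (hfin.image _) ?_
    rintro _ ⟨R, hR, rfl⟩
    obtain ⟨v, hv⟩ := (h𝓡 R hR).exists_isPartialTranslation
    have hsupp : operatorSupport v ⊆ R := fun p hp => not_not.1 fun h =>
      hp (hv.entry_of_notMem p.1 p.2 h)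
    obtain ⟨a, rfl⟩ := (hj.mem_range_iff v).1 (mem_uniformRoeAlgebra_of_operatorSupport_mem
      (𝓔.subset_mem _ hE _ (hsupp.trans (Set.subset_sUnion_of_mem hR))))
    have hmem : {p : MinimalProjection B × MinimalProjection B | 1 ≤ ‖p.1.1 * a * p.2.1‖} ∈
        (cartanCoarseStructure B).entourages :=
      CoarseStructure.mem_generate ⟨a, hj.mem_normaliser (h𝓡 R hR) hsupp, 1, one_pos, rfl⟩
    refine CoarseStructure.subset_mem _ _ hmem _ ?_
    rintro _ ⟨⟨x, y⟩, hxy, rfl⟩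
    change 1 ≤ ‖(e x).1 * a * (e y).1‖
    rw [hj.norm_mul_mul he, hv.entry_of_mem x y hxy, norm_one]
  · intro hE
    -- The generated structure is an intersection, so it suffices to test against `𝓔` carried over
    -- by `e`.
    have h := hE (𝓔.mapEquiv e) (by
      rintro _ ⟨a, -, ε, hε, rfl⟩
      have ha : j a ∈ closure (finitePropagation 𝓔 : Set (L2Op X)) :=
        (hj.mem_range_iff _).2 ⟨a, rfl⟩
      obtain ⟨T, hT, haT⟩ := Metric.mem_closure_iff.1 ha ε hε
      refine 𝓔.subset_mem _ hT _ ?_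
      rintro ⟨x, y⟩ (hxy : ε ≤ ‖(e x).1 * a * (e y).1‖)
      rw [hj.norm_mul_mul he] at hxy
      intro h0
      have h1 := norm_matrixEntry_le (j a - T) x y
      rw [matrixEntry_sub, show matrixEntry T x y = 0 from h0, sub_zero, ← dist_eq_norm] at h1
      linarith)
    have h2 : Prod.map e e ⁻¹' (Prod.map e e '' E) ∈ 𝓔.entourages := h
    rwa [Set.preimage_image_eq E (e.injective.prodMap e.injective)] at h2

end IsRoeRepresentation

end Minimal

/-! ### Irreducible representations of the compact operators -/

section Irreducible

open InnerProductSpace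

theorem rankOne_self_apply_eq_zero {H : Type w} [NormedAddCommGroup H]
    [InnerProductSpace ℂ H] {ξ : H} (h : rankOne ℂ ξ ξ ξ = 0) : ξ = 0 := by
  rw [rankOne_apply, smul_eq_zero, inner_self_eq_zero, or_self] at h
  exact h

variable {R : Type u} [NonUnitalRing R] [StarRing R] [Module ℂ R]
  {H₀ : Type*} [NormedAddCommGroup H₀] [InnerProductSpace ℂ H₀] [CompleteSpace H₀]
  {H : Type w} [NormedAddCommGroup H] [InnerProductSpace ℂ H] [CompleteSpace H]

theorem rankOne_mem_compactOperators (ξ η : H) : rankOne ℂ ξ η ∈ compactOperators H :=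
  isCompactOperator_rankOne ξ η

/-- The identity representation of the compact operators is irreducible. -/
theorem isIrreducibleRep_of_equiv (φ : R ≃⋆ₐ[ℂ] compactOperators H) (π : R →⋆ₙₐ[ℂ] (H →L[ℂ] H))
    (hπ : ∀ r, π r = φ r) : IsIrreducibleRep π where
  nondegenerate ξ h := by
    refine rankOne_self_apply_eq_zero ?_
    have := h (φ.symm ⟨_, rankOne_mem_compactOperators ξ ξ⟩)
    rwa [hπ, StarAlgEquiv.apply_symm_apply] at this
  irreducible V _ hV := by
    refine or_iff_not_imp_left.2 fun hne => ?_
    obtain ⟨v, hv, hv0⟩ := (Submodule.ne_bot_iff V).1 hne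
    refine eq_top_iff.2 fun ξ _ => ?_
    -- The rank-one operator `|ξ⟩⟨v|` sends `v` to a nonzero multiple of the arbitrary vector `ξ`.
    have := hV (φ.symm ⟨_, rankOne_mem_compactOperators ξ v⟩) v hv
    rw [hπ, StarAlgEquiv.apply_symm_apply] at this
    exact (V.smul_mem_iff (inner_self_ne_zero.2 hv0)).1 this

/-- A faithful irreducible representation of the compact operators is unitarily equivalent to the
identity representation. -/
theorem IsIrreducibleRep.exists_unitary {π : R →⋆ₙₐ[ℂ] (H →L[ℂ] H)} (hirr : IsIrreducibleRep π)
    (hinj : Function.Injective π) (φ : R ≃⋆ₐ[ℂ] compactOperators H₀) :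
    ∃ U : H₀ ≃ₗᵢ[ℂ] H, ∀ r ξ, π r (U ξ) = U ((φ r : H₀ →L[ℂ] H₀) ξ) := by
  -- If `H₀ = 0` there is no unit vector to work with; then `R = 0`, and nondegeneracy forces `H =
  -- 0`.
  obtain hs | hn := subsingleton_or_nontrivial H₀
  · have hR : ∀ r : R, r = 0 := fun r => φ.injective (Subtype.ext (by
      ext ξ
      exact Subsingleton.elim _ _))
    have hH : Subsingleton H := subsingleton_of_forall_eq 0 fun ξ =>
      hirr.nondegenerate ξ fun r => by rw [hR r, map_zero]; rfl
    exact ⟨⟨0, fun ξ => by rw [Subsingleton.elim ξ 0, map_zero, norm_zero, norm_zero]⟩,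
      fun r ξ => Subsingleton.elim _ _⟩
  obtain ⟨e, he⟩ := exists_norm_eq H₀ zero_le_one
  have hee : inner ℂ e e = (1 : ℂ) := by rw [inner_self_eq_norm_sq_to_K, he]; simp
  -- The operators `|ξ⟩⟨e|` form a left ideal, a copy of `H₀` on which left multiplication by `R` is
  -- the original action.
  set κ : H₀ → R := fun ξ => φ.symm ⟨rankOne ℂ ξ e, rankOne_mem_compactOperators ξ e⟩ with hκ
  have hφκ : ∀ ξ, (φ (κ ξ) : H₀ →L[ℂ] H₀) = rankOne ℂ ξ e := fun ξ => by
    rw [hκ, StarAlgEquiv.apply_symm_apply]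
  have hinjφ : ∀ r s : R, (φ r : H₀ →L[ℂ] H₀) = φ s → r = s := fun r s h =>
    φ.injective (Subtype.ext h)
  have hadd : ∀ ξ ξ', κ (ξ + ξ') = κ ξ + κ ξ' := fun ξ ξ' => hinjφ _ _ (by
    rw [map_add]
    change _ = (φ (κ ξ) : H₀ →L[ℂ] H₀) + φ (κ ξ')
    simp only [hφκ, map_add, add_apply])
  have hsmul : ∀ (c : ℂ) ξ, κ (c • ξ) = c • κ ξ := fun c ξ => hinjφ _ _ (by
    rw [map_smul]
    change _ = c • (φ (κ ξ) : H₀ →L[ℂ] H₀)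
    simp only [hφκ, map_smul, smul_apply])
  have hmul : ∀ r ξ, r * κ ξ = κ ((φ r : H₀ →L[ℂ] H₀) ξ) := fun r ξ => hinjφ _ _ (by
    rw [map_mul]
    change (φ r : H₀ →L[ℂ] H₀) * φ (κ ξ) = _
    rw [hφκ, hφκ]
    exact comp_rankOne _ _ _)
  have hstar : ∀ ξ, star (κ ξ) * κ ξ = (inner ℂ ξ ξ : ℂ) • κ e := fun ξ => hinjφ _ _ (by
    rw [map_mul, map_star, map_smul]
    change star (φ (κ ξ) : H₀ →L[ℂ] H₀) * φ (κ ξ) = (inner ℂ ξ ξ : ℂ) • (φ (κ e) : H₀ →L[ℂ] H₀)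
    rw [hφκ, hφκ, ContinuousLinearMap.star_eq_adjoint, adjoint_rankOne]
    ext ζ
    change rankOne ℂ e ξ (rankOne ℂ ξ e ζ) = (inner ℂ ξ ξ : ℂ) • rankOne ℂ e e ζ
    simp only [rankOne_apply, map_smul, smul_smul]
    rw [mul_comm])
  have hκe : κ e ≠ 0 := fun h => by
    have h1 := hφκ e
    rw [h, map_zero] at h1
    have h2 : (0 : H₀) = rankOne ℂ e e e := congrArg (fun T : H₀ →L[ℂ] H₀ => T e) h1
    have := rankOne_self_apply_eq_zero h2.symm
    rw [this, norm_zero] at he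
    exact zero_ne_one he
  obtain ⟨η₀, hη₀⟩ : ∃ η, π (κ e) η ≠ 0 := by
    by_contra! h
    refine hκe (hinj ?_)
    rw [map_zero]
    ext η
    exact h η
  have hidem : κ e * κ e = κ e := by
    rw [hmul, hφκ, rankOne_apply, hee, one_smul]
  -- A unit vector in the range of the projection `π (κ e)` plays the role of `e` in `H`.
  obtain ⟨η, hη1, hη⟩ : ∃ η : H, ‖η‖ = 1 ∧ π (κ e) η = η := by
    refine ⟨((‖π (κ e) η₀‖ : ℂ)⁻¹) • π (κ e) η₀, norm_smul_inv_norm hη₀, ?_⟩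
    rw [map_smul]
    congr 1
    rw [← ContinuousLinearMap.comp_apply, ← ContinuousLinearMap.mul_def, ← map_mul, hidem]
  have hηη : inner ℂ η η = (1 : ℂ) := by rw [inner_self_eq_norm_sq_to_K, hη1]; simp
  -- The map is isometric because `κ(ξ)* κ(ξ) = ⟨ξ, ξ⟩ κ(e)` and `π (κ e)` fixes `η`.
  let U₀ : H₀ →ₗᵢ[ℂ] H :=
    { toFun := fun ξ => π (κ ξ) η
      map_add' := fun ξ ξ' => by rw [hadd, map_add]; rfl
      map_smul' := fun c ξ => by rw [hsmul, map_smul]; rfl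
      norm_map' := fun ξ => by
        have h1 : (inner ℂ (π (κ ξ) η) (π (κ ξ) η) : ℂ) = inner ℂ ξ ξ := by
          rw [← ContinuousLinearMap.adjoint_inner_right, ← ContinuousLinearMap.star_eq_adjoint,
            ← map_star, ← ContinuousLinearMap.comp_apply, ← ContinuousLinearMap.mul_def,
            ← map_mul, hstar, map_smul, smul_apply, hη, inner_smul_right, hηη, mul_one]
        rw [inner_self_eq_norm_sq_to_K, inner_self_eq_norm_sq_to_K] at h1
        have h2 : ‖π (κ ξ) η‖ ^ 2 = ‖ξ‖ ^ 2 := by exact_mod_cast h1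
        exact (sq_eq_sq₀ (norm_nonneg _) (norm_nonneg _)).1 h2 }
  have hU₀ : ∀ r ξ, π r (U₀ ξ) = U₀ ((φ r : H₀ →L[ℂ] H₀) ξ) := fun r ξ => by
    change π r (π (κ ξ) η) = π (κ _) η
    rw [← hmul, map_mul]
    rfl
  -- The range is closed, invariant and nonzero, so irreducibility makes it everything.
  have hrange : LinearMap.range U₀.toLinearMap = ⊤ := by
    refine (hirr.irreducible _ ?_ ?_).resolve_left fun h => ?_
    · exact U₀.isometry.isClosedEmbedding.isClosed_range
    · rintro r _ ⟨ξ, rfl⟩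
      exact ⟨_, (hU₀ r ξ).symm⟩
    · have h1 : U₀ e ∈ LinearMap.range U₀.toLinearMap := ⟨e, rfl⟩
      rw [h, Submodule.mem_bot] at h1
      have h2 := U₀.norm_map e
      rw [h1, norm_zero, he] at h2
      exact zero_ne_one h2
  exact ⟨LinearIsometryEquiv.ofSurjective U₀ (LinearMap.range_eq_top.1 hrange), hU₀⟩

/-- Conjugation by the unitary intertwiner carries the compacts on `H₀` exactly onto those on `H`.
-/
theorem IsIrreducibleRep.isCompactOperator_and_surjective {π : R →⋆ₙₐ[ℂ] (H →L[ℂ] H)}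
    (hirr : IsIrreducibleRep π) (hinj : Function.Injective π)
    (φ : R ≃⋆ₐ[ℂ] compactOperators H₀) :
    (∀ r, π r ∈ compactOperators H) ∧ ∀ T ∈ compactOperators H, ∃ r, π r = T := by
  obtain ⟨U, hU⟩ := hirr.exists_unitary hinj φ
  let V : H₀ →L[ℂ] H := U.toContinuousLinearEquiv
  let W : H →L[ℂ] H₀ := U.symm.toContinuousLinearEquiv
  refine ⟨fun r => ?_, fun T hT => ?_⟩
  · have h : π r = V ∘L (φ r : H₀ →L[ℂ] H₀) ∘L W := by
      ext ξ
      have := hU r (U.symm ξ)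
      rw [U.apply_symm_apply] at this
      exact this
    rw [h]
    exact (IsCompactOperator.comp_clm (φ r).2 W).clm_comp V
  · have hT' : W ∘L T ∘L V ∈ compactOperators H₀ := (IsCompactOperator.comp_clm hT V).clm_comp W
    refine ⟨φ.symm ⟨_, hT'⟩, ?_⟩
    ext ξ
    have := hU (φ.symm ⟨_, hT'⟩) (U.symm ξ)
    rw [U.apply_symm_apply, StarAlgEquiv.apply_symm_apply] at this
    rw [this]
    change U (U.symm (T (U (U.symm ξ)))) = T ξ
    rw [U.apply_symm_apply, U.apply_symm_apply]

end Irreducible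

/-! ### Extending representations from an essential ideal -/

section Extension

open InnerProductSpace

variable {A : Type u} [CStarAlgebra A] {K : NonUnitalStarSubalgebra ℂ A}
  {H : Type w} [NormedAddCommGroup H] [InnerProductSpace ℂ H] [CompleteSpace H]
  {ψ : K →⋆ₙₐ[ℂ] (H →L[ℂ] H)}

/-- Each nonzero `ξ` is, up to a nonzero scalar, the value at `ξ` of the rank-one operator `|ξ⟩⟨ξ|`.
This makes an operator determined by its products with the compacts. -/
theorem eq_of_forall_mul_eq (hsurj : ∀ T ∈ compactOperators H, ∃ k, ψ k = T) {S T : H →L[ℂ] H}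
    (h : ∀ k, S * ψ k = T * ψ k) : S = T := by
  refine sub_eq_zero.1 (ContinuousLinearMap.ext fun ξ => ?_)
  by_cases hξ : ξ = 0
  · rw [hξ, map_zero, map_zero]
  obtain ⟨k, hk⟩ := hsurj _ (rankOne_mem_compactOperators ξ ξ)
  have h1 : (S - T) (ψ k ξ) = 0 := by
    have := congrArg (fun P : H →L[ℂ] H => P ξ) (h k)
    rw [sub_apply, sub_eq_zero]
    exact this
  rw [hk, rankOne_apply, map_smul, smul_eq_zero] at h1
  exact h1.resolve_left (inner_self_ne_zero.2 hξ)

/-- With `ψ (κ ξ) = |ξ⟩⟨e|` for a unit vector `e`, the operator must be `T ξ = ψ (a κ(ξ)) e`. It is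
bounded by `‖a‖` because the faithful `ψ` is isometric. -/
theorem exists_mul_eq (hK : IsEssentialIdeal K) (hinj : Function.Injective ψ)
    (hsurj : ∀ T ∈ compactOperators H, ∃ k, ψ k = T) (a : A) :
    ∃ T : H →L[ℂ] H, ∀ k : K, T * ψ k = ψ ⟨a * k, hK.mul_mem_left a k k.2⟩ := by
  have : IsClosed (K : Set A) := hK.isClosed
  have hnorm : ∀ k : K, ‖ψ k‖ = ‖k‖ := NonUnitalStarAlgHom.norm_map ψ hinj
  obtain hs | hn := subsingleton_or_nontrivial H
  · exact ⟨0, fun k => ContinuousLinearMap.ext fun ξ => Subsingleton.elim _ _⟩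
  obtain ⟨e, he⟩ := exists_norm_eq H zero_le_one
  have hee : inner ℂ e e = (1 : ℂ) := by rw [inner_self_eq_norm_sq_to_K, he]; simp
  choose κ hκ using fun ξ : H => hsurj _ (rankOne_mem_compactOperators ξ e)
  have hadd : ∀ ξ ξ', κ (ξ + ξ') = κ ξ + κ ξ' := fun ξ ξ' => hinj (by
    simp only [map_add, hκ, add_apply])
  have hsmul : ∀ (c : ℂ) ξ, κ (c • ξ) = c • κ ξ := fun c ξ => hinj (by
    simp only [map_smul, hκ, smul_apply])
  have hmul : ∀ k ξ, κ (ψ k ξ) = k * κ ξ := fun k ξ => hinj (by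
    rw [map_mul, hκ, hκ]
    exact (comp_rankOne _ _ _).symm)
  let L : H →ₗ[ℂ] H :=
    { toFun := fun ξ => ψ ⟨a * κ ξ, hK.mul_mem_left a _ (κ ξ).2⟩ e
      map_add' := fun ξ ξ' => by
        have : (⟨a * κ (ξ + ξ'), hK.mul_mem_left a _ (κ (ξ + ξ')).2⟩ : K)
            = ⟨a * κ ξ, hK.mul_mem_left a _ (κ ξ).2⟩ + ⟨a * κ ξ', hK.mul_mem_left a _ (κ ξ').2⟩ :=
          Subtype.ext (by rw [hadd]; exact mul_add _ _ _)
        rw [this, map_add]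
        rfl
      map_smul' := fun c ξ => by
        have : (⟨a * κ (c • ξ), hK.mul_mem_left a _ (κ (c • ξ)).2⟩ : K)
            = c • ⟨a * κ ξ, hK.mul_mem_left a _ (κ ξ).2⟩ :=
          Subtype.ext (by rw [hsmul]; exact mul_smul_comm _ _ _)
        rw [this, map_smul]
        rfl }
  refine ⟨L.mkContinuous ‖a‖ fun ξ => ?_, fun k => ContinuousLinearMap.ext fun ξ => ?_⟩
  · refine ((ψ _).le_opNorm e).trans ?_
    rw [he, mul_one, hnorm]
    refine (norm_mul_le a (κ ξ : A)).trans ?_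
    have : ‖(κ ξ : A)‖ = ‖ξ‖ := by
      change ‖κ ξ‖ = ‖ξ‖
      rw [← hnorm, hκ, norm_rankOne, he, mul_one]
    rw [this]
  · have h1 : (⟨a * κ (ψ k ξ), hK.mul_mem_left a _ (κ (ψ k ξ)).2⟩ : K)
        = ⟨a * k, hK.mul_mem_left a k k.2⟩ * κ ξ :=
      Subtype.ext (by rw [hmul]; exact (mul_assoc _ _ _).symm)
    change ψ ⟨a * κ (ψ k ξ), _⟩ e = _
    rw [h1, map_mul, hκ, ContinuousLinearMap.mul_def, ContinuousLinearMap.comp_apply,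
      rankOne_apply, hee, one_smul]

/-- A faithful representation of an essential ideal onto the compact operators extends to the
algebra. -/
theorem exists_extension (hK : IsEssentialIdeal K) (hinj : Function.Injective ψ)
    (hsurj : ∀ T ∈ compactOperators H, ∃ k, ψ k = T) :
    ∃ π : A →⋆ₐ[ℂ] (H →L[ℂ] H), ∀ k : K, π k = ψ k := by
  choose π hπ using exists_mul_eq hK hinj hsurj
  have huniq : ∀ a T, (∀ k : K, T * ψ k = ψ ⟨a * k, hK.mul_mem_left a k k.2⟩) → π a = T :=
    fun a T h => eq_of_forall_mul_eq hsurj fun k => by rw [hπ, h]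
  refine ⟨
    { toFun := π
      map_one' := huniq _ _ fun k => by
        rw [one_mul]; congr 1; exact Subtype.ext (one_mul _).symm
      map_mul' := fun a b => huniq _ _ fun k => by
        rw [mul_assoc, hπ, hπ]; congr 1; exact Subtype.ext (mul_assoc _ _ _).symm
      map_zero' := huniq _ _ fun k => by
        rw [zero_mul, ← map_zero ψ]; congr 1; exact Subtype.ext (zero_mul _).symm
      map_add' := fun a b => huniq _ _ fun k => by
        rw [add_mul, hπ, hπ, ← map_add]; congr 1; exact Subtype.ext (add_mul _ _ _).symm
      commutes' := fun c => huniq _ _ fun k => by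
        rw [Algebra.algebraMap_eq_smul_one, smul_mul_assoc, one_mul, ← map_smul]
        congr 1
        refine Subtype.ext ?_
        change c • (k : A) = algebraMap ℂ A c * k
        rw [Algebra.algebraMap_eq_smul_one, smul_mul_assoc, one_mul]
      -- The defining identity has `ψ k` on the right only. Taking adjoints moves `ψ l` to the left
      -- of `π a`, and a second test element `k` brings the identity for `a` back into play.
      map_star' := fun a => huniq _ _ fun l => by
        refine star_injective ?_
        rw [star_mul, star_star, ← map_star, ← map_star]
        refine eq_of_forall_mul_eq hsurj fun k => ?_
        rw [mul_assoc, hπ, ← map_mul, ← map_mul]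
        congr 1
        refine Subtype.ext ?_
        change star (l : A) * (a * k) = star (star a * l) * k
        rw [star_mul, star_star, mul_assoc] },
    fun k => huniq _ _ fun l => ?_⟩
  rw [← map_mul]
  rfl

theorem extension_unique (hK : IsEssentialIdeal K)
    (hsurj : ∀ T ∈ compactOperators H, ∃ k, ψ k = T) {π π' : A →⋆ₐ[ℂ] (H →L[ℂ] H)}
    (hπ : ∀ k : K, π k = ψ k) (hπ' : ∀ k : K, π' k = ψ k) : π = π' := by
  refine StarAlgHom.ext fun a => eq_of_forall_mul_eq hsurj fun k => ?_
  have h1 := hπ ⟨a * k, hK.mul_mem_left a k k.2⟩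
  have h2 := hπ' ⟨a * k, hK.mul_mem_left a k k.2⟩
  simp only [map_mul, hπ, hπ'] at h1 h2
  rw [h1, h2]

/-- An element of the kernel multiplies `K` into the kernel of `ψ`, so it annihilates `K`. -/
theorem extension_injective (hK : IsEssentialIdeal K) (hinj : Function.Injective ψ)
    {π : A →⋆ₐ[ℂ] (H →L[ℂ] H)} (hπ : ∀ k : K, π k = ψ k) : Function.Injective π := by
  rw [injective_iff_map_eq_zero]
  refine fun a ha => hK.essential a fun k hk => ?_
  have h : (⟨a * k, hK.mul_mem_left a k hk⟩ : K) = 0 := hinj (by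
    rw [map_zero, ← hπ, map_mul, ha, zero_mul])
  exact congrArg Subtype.val h

end Extension

/-! ### Minimal projections of a Cartan subalgebra -/

section MinimalProjections

variable {A : Type u} [CStarAlgebra A] {B : NonUnitalStarSubalgebra ℂ A} {I : Type u}

open Classical in
/-- The indicator function of a point, in `ℓ^∞`. -/
noncomputable def pointIndicator (i : I) : ℓ^∞(I, ℂ) := lp.single ∞ i 1

theorem pointIndicator_apply_self (i : I) : (pointIndicator i : ℓ^∞(I, ℂ)) i = 1 := by
  classical
  simp [pointIndicator]

theorem pointIndicator_apply_ne {i k : I} (h : k ≠ i) : (pointIndicator i : ℓ^∞(I, ℂ)) k = 0 := by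
  classical
  simp [pointIndicator, h]

theorem mul_pointIndicator (f : ℓ^∞(I, ℂ)) (i : I) :
    f * pointIndicator i = f i • pointIndicator i := by
  refine lp.ext (funext fun k => ?_)
  rw [lp.infty_coeFn_mul, lp.coeFn_smul, Pi.mul_apply, Pi.smul_apply, smul_eq_mul]
  by_cases h : k = i
  · rw [h]
  · rw [pointIndicator_apply_ne h, mul_zero, mul_zero]

theorem pointIndicator_mul (f : ℓ^∞(I, ℂ)) (i : I) :
    pointIndicator i * f = f i • pointIndicator i := by
  rw [← mul_pointIndicator]
  refine lp.ext (funext fun k => ?_)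
  rw [lp.infty_coeFn_mul, lp.infty_coeFn_mul, mul_comm]

theorem star_pointIndicator (i : I) : star (pointIndicator i : ℓ^∞(I, ℂ)) = pointIndicator i := by
  refine lp.ext (funext fun k => ?_)
  rw [lp.star_apply]
  by_cases h : k = i
  · rw [h, pointIndicator_apply_self, star_one]
  · rw [pointIndicator_apply_ne h, star_zero]

/-- The minimal projection of `B ≅ ℓ^∞(I)` given by a point of `I`. -/
noncomputable def minimalProjectionOf (φ : B ≃⋆ₐ[ℂ] ℓ^∞(I, ℂ)) (i : I) : MinimalProjection B := by
  refine ⟨φ.symm (pointIndicator i), (φ.symm (pointIndicator i)).2, ⟨?_, ?_⟩, fun h => ?_,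
    fun b hb => ⟨φ ⟨b, hb⟩ i, ?_⟩⟩
  · change ((φ.symm (pointIndicator i) * φ.symm (pointIndicator i) : B) : A) = _
    rw [← map_mul, mul_pointIndicator, pointIndicator_apply_self, one_smul]
  · change ((star (φ.symm (pointIndicator i)) : B) : A) = _
    rw [← map_star, star_pointIndicator]
  · have h0 : φ.symm (pointIndicator i) = 0 := Subtype.ext h
    have h1 : pointIndicator i = 0 := φ.symm.injective (h0.trans (map_zero _).symm)
    have h2 := pointIndicator_apply_self i
    rw [h1] at h2
    exact zero_ne_one h2
  · change ((φ.symm (pointIndicator i) * ⟨b, hb⟩ * φ.symm (pointIndicator i) : B) : A)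
      = ((φ ⟨b, hb⟩ i • φ.symm (pointIndicator i) : B) : A)
    congr 1
    refine EquivLike.injective φ ?_
    rw [map_mul, map_mul, map_smul, StarAlgEquiv.apply_symm_apply, pointIndicator_mul,
      smul_mul_assoc, mul_pointIndicator, pointIndicator_apply_self, one_smul]

theorem minimalProjectionOf_mul (φ : B ≃⋆ₐ[ℂ] ℓ^∞(I, ℂ)) (i : I) (b : B) :
    (minimalProjectionOf φ i).1 * b = φ b i • (minimalProjectionOf φ i).1 := by
  change ((φ.symm (pointIndicator i) * b : B) : A)
      = ((φ b i • φ.symm (pointIndicator i) : B) : A)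
  congr 1
  refine EquivLike.injective φ ?_
  rw [map_mul, map_smul, StarAlgEquiv.apply_symm_apply, pointIndicator_mul]

theorem MinimalProjection.isIdempotentElem (p : MinimalProjection B) : p.1 * p.1 = p.1 :=
  p.2.2.1.isIdempotentElem

theorem MinimalProjection.star_eq (p : MinimalProjection B) : star p.1 = p.1 :=
  p.2.2.1.isSelfAdjoint

theorem eq_zero_of_forall_minimalProjection_mul (φ : B ≃⋆ₐ[ℂ] ℓ^∞(I, ℂ)) {b : A} (hb : b ∈ B)
    (h : ∀ p : MinimalProjection B, p.1 * b = 0) : b = 0 := by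
  have h0 : φ ⟨b, hb⟩ = 0 := lp.ext (funext fun i => by
    have h1 := h (minimalProjectionOf φ i)
    rw [show b = (⟨b, hb⟩ : B) from rfl, minimalProjectionOf_mul, smul_eq_zero] at h1
    exact h1.resolve_right (minimalProjectionOf φ i).2.2.2.1)
  exact congrArg Subtype.val (φ.injective (h0.trans (map_zero φ).symm))

/-- In a commutative `B`, a minimal projection acts on `B` by scalars. -/
theorem MinimalProjection.exists_mul_eq (hB : ∀ x ∈ B, ∀ y ∈ B, x * y = y * x)
    (p : MinimalProjection B) {b : A} (hb : b ∈ B) :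
    ∃ c : ℂ, p.1 * b = c • p.1 ∧ b * p.1 = c • p.1 := by
  obtain ⟨c, hc⟩ := p.2.2.2.2 b hb
  have h : p.1 * b = c • p.1 := by
    rw [← hc, hB _ (mul_mem p.2.1 hb) _ p.2.1, ← mul_assoc, p.isIdempotentElem]
  exact ⟨c, h, by rw [hB _ hb _ p.2.1, h]⟩

/-- The product is a multiple of `p`; if nonzero, multiplying once more by `q` forces the scalar to
be 1, so `p q = p`. By symmetry also `q p = q`, and `p = q`. -/
theorem MinimalProjection.mul_eq_zero (hB : ∀ x ∈ B, ∀ y ∈ B, x * y = y * x)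
    {p q : MinimalProjection B} (hpq : p ≠ q) : p.1 * q.1 = 0 := by
  by_contra hne
  have key : ∀ p q : MinimalProjection B, p.1 * q.1 ≠ 0 → p.1 * q.1 = p.1 := by
    intro p q hne
    obtain ⟨c, hc, -⟩ := p.exists_mul_eq hB q.2.1
    have h1 : p.1 * q.1 * q.1 = p.1 * q.1 := by rw [mul_assoc, q.isIdempotentElem]
    rw [hc, smul_mul_assoc, hc] at h1
    rw [hc] at hne
    have hc0 : c ≠ 0 := fun h => hne (by rw [h, zero_smul])
    rw [hc]
    exact smul_right_injective A hc0 h1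
  refine hpq (Subtype.ext ?_)
  have h1 := key p q hne
  rw [hB _ p.2.1 _ q.2.1] at hne h1
  rw [← h1, key q p hne]

/-- Every minimal projection is given by a point. -/
theorem exists_minimalProjectionOf_eq (hB : ∀ x ∈ B, ∀ y ∈ B, x * y = y * x)
    (φ : B ≃⋆ₐ[ℂ] ℓ^∞(I, ℂ)) (p : MinimalProjection B) : ∃ i, minimalProjectionOf φ i = p := by
  by_contra! h
  refine p.2.2.2.1 ?_
  have h0 : φ ⟨p.1, p.2.1⟩ = 0 := lp.ext (funext fun i => by
    have h1 := MinimalProjection.mul_eq_zero hB (h i)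
    rw [show p.1 = (⟨p.1, p.2.1⟩ : B) from rfl, minimalProjectionOf_mul, smul_eq_zero] at h1
    exact h1.resolve_right (minimalProjectionOf φ i).2.2.2.1)
  exact congrArg Subtype.val (φ.injective (h0.trans (map_zero φ).symm))

theorem exists_mem_forall_minimalProjection_mul_eq (hB : ∀ x ∈ B, ∀ y ∈ B, x * y = y * x)
    (φ : B ≃⋆ₐ[ℂ] ℓ^∞(I, ℂ)) (f : ℓ^∞(MinimalProjection B, ℂ)) :
    ∃ b ∈ B, ∀ p : MinimalProjection B, p.1 * b = f p • p.1 := by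
  set g : ℓ^∞(I, ℂ) := boundedFun (fun i => f (minimalProjectionOf φ i)) ‖f‖ fun i =>
    lp.norm_apply_le_norm (by simp) f _
  refine ⟨φ.symm g, (φ.symm g).2, fun p => ?_⟩
  obtain ⟨i, rfl⟩ := exists_minimalProjectionOf_eq hB φ p
  rw [minimalProjectionOf_mul, StarAlgEquiv.apply_symm_apply]
  rfl

/-- The algebra generated by `B` and `x` is commutative, so maximality makes it equal to `B`.
Self-adjointness of `x` keeps the generating set closed under `star`. -/
theorem IsCartanSubalgebra.mem_of_commute (hB : IsCartanSubalgebra B) {x : A}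
    (hx : IsSelfAdjoint x) (hcomm : ∀ b ∈ B, x * b = b * x) : x ∈ B := by
  have hs : ∀ y ∈ insert x (B : Set A), ∀ z ∈ insert x (B : Set A), y * z = z * y := by
    rintro y (rfl | hy) z (rfl | hz)
    · rfl
    · exact hcomm z hz
    · exact (hcomm y hy).symm
    · exact hB.commutative y hy z hz
  have hs' : ∀ y ∈ insert x (B : Set A), star y ∈ insert x (B : Set A) := by
    rintro y (rfl | hy)
    · exact Or.inl hx.star_eq
    · exact Or.inr (star_mem hy)
  have hC := NonUnitalStarAlgebra.isMulCommutative_adjoin ℂ hs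
    fun y hy z hz => hs y hy _ (hs' z hz)
  have := hB.maximal (NonUnitalStarAlgebra.adjoin ℂ (insert x (B : Set A)))
    (fun y hy z hz => congrArg Subtype.val (hC.is_comm.comm ⟨y, hy⟩ ⟨z, hz⟩))
    fun y hy => NonUnitalStarAlgebra.subset_adjoin ℂ _ (Or.inr hy)
  rw [← this]
  exact NonUnitalStarAlgebra.subset_adjoin ℂ _ (Or.inl rfl)

/-- A minimal projection of a Cartan subalgebra is minimal in the ambient algebra. -/
theorem IsCartanSubalgebra.exists_mul_mul_eq (hB : IsCartanSubalgebra B)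
    (p : MinimalProjection B) (a : A) : ∃ c : ℂ, p.1 * a * p.1 = c • p.1 := by
  have key : ∀ a : A, IsSelfAdjoint a → ∃ c : ℂ, p.1 * a * p.1 = c • p.1 := by
    intro a ha
    -- Every `b ∈ B` acts on `p` from either side by the same scalar, so it commutes with `p a p`.
    have hmem : p.1 * a * p.1 ∈ B := by
      refine hB.mem_of_commute ?_ fun b hb => ?_
      · change star _ = _
        rw [star_mul, star_mul, p.star_eq, ha.star_eq, mul_assoc]
      · obtain ⟨c, h1, h2⟩ := p.exists_mul_eq hB.commutative hb
        rw [mul_assoc, h1, ← mul_assoc, ← mul_assoc, h2, mul_smul_comm, smul_mul_assoc,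
          smul_mul_assoc]
    obtain ⟨c, hc⟩ := p.2.2.2.2 _ hmem
    refine ⟨c, ?_⟩
    rw [← hc]
    simp only [← mul_assoc, p.isIdempotentElem]
    rw [mul_assoc _ p.1 p.1, p.isIdempotentElem]
  -- The general case follows by linearity from the real and imaginary parts.
  obtain ⟨c, hc⟩ := key _ (realPart a).2
  obtain ⟨d, hd⟩ := key _ (imaginaryPart a).2
  refine ⟨c + Complex.I * d, ?_⟩
  conv_lhs => rw [← realPart_add_I_smul_imaginaryPart a]
  rw [mul_add, add_mul, mul_smul_comm, smul_mul_assoc, hc, hd, add_smul, mul_smul]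

end MinimalProjections

/-! ### An orthonormal basis from the minimal projections -/

section Basis

open InnerProductSpace

variable {A : Type u} [CStarAlgebra A] {B K : NonUnitalStarSubalgebra ℂ A}
  {H : Type w} [NormedAddCommGroup H] [InnerProductSpace ℂ H] [CompleteSpace H]
  {π : A →⋆ₐ[ℂ] (H →L[ℂ] H)}

/-- Fix a unit vector `e` in the range of `π p`. For any `ξ`, some `k` is represented by `|π(p)
ξ⟩⟨e|`; minimality of `p` in `A` gives `p k p = c p`, and applying this to `e` yields `π(p) ξ = c
e`. -/
theorem exists_eq_rankOne (hB : IsCartanSubalgebra B) (hinj : Function.Injective π)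
    (hsurj : ∀ T ∈ compactOperators H, ∃ k, π k = T) (p : MinimalProjection B) :
    ∃ e : H, ‖e‖ = 1 ∧ π p.1 = rankOne ℂ e e := by
  obtain ⟨η₀, hη₀⟩ : ∃ η, π p.1 η ≠ 0 := by
    by_contra! h
    refine p.2.2.2.1 (hinj ?_)
    rw [map_zero]
    ext η
    exact h η
  have hidem : ∀ ξ, π p.1 (π p.1 ξ) = π p.1 ξ := fun ξ => by
    rw [← ContinuousLinearMap.comp_apply, ← ContinuousLinearMap.mul_def, ← map_mul,
      p.isIdempotentElem]
  have hsymm : ∀ ξ η, (inner ℂ (π p.1 ξ) η : ℂ) = inner ℂ ξ (π p.1 η) := fun ξ η => by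
    rw [← ContinuousLinearMap.adjoint_inner_right, ← ContinuousLinearMap.star_eq_adjoint,
      ← map_star, p.star_eq]
  obtain ⟨e, he1, he⟩ : ∃ e : H, ‖e‖ = 1 ∧ π p.1 e = e := by
    refine ⟨((‖π p.1 η₀‖ : ℂ)⁻¹) • π p.1 η₀, norm_smul_inv_norm hη₀, ?_⟩
    rw [map_smul, hidem]
  have hee : inner ℂ e e = (1 : ℂ) := by rw [inner_self_eq_norm_sq_to_K, he1]; simp
  refine ⟨e, he1, ContinuousLinearMap.ext fun ξ => ?_⟩
  obtain ⟨k, hk⟩ := hsurj _ (rankOne_mem_compactOperators (π p.1 ξ) e)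
  obtain ⟨c, hc⟩ := hB.exists_mul_mul_eq p k
  have h1 := congrArg (fun a => π a e) hc
  have h2 : π p.1 (π k (π p.1 e)) = c • π p.1 e := by
    simp only [map_mul, map_smul] at h1
    exact h1
  rw [he, hk, rankOne_apply, hee, one_smul, hidem] at h2
  rw [rankOne_apply, ← he, hsymm, h2, inner_smul_right, hee, mul_one, he]

/-- Orthogonality of the projections gives an orthonormal family of unit vectors. Completeness comes
from the faithful expectation, which forbids a nonzero vector orthogonal to all of them. -/
theorem exists_unitary_of_isCartanTriple (hT : IsCartanTriple B K) (hinj : Function.Injective π)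
    (hsurj : ∀ T ∈ compactOperators H, ∃ k, π k = T) :
    ∃ u : ℓ²(MinimalProjection B, ℂ) ≃ₗᵢ[ℂ] H,
      ∀ p : MinimalProjection B, π p.1 = rankOne ℂ (u (delta p)) (u (delta p)) := by
  classical
  choose e he hπ using exists_eq_rankOne hT.cartan hinj hsurj
  have hself : ∀ p, π p.1 (e p) = e p := fun p => by
    rw [hπ, rankOne_apply, inner_self_eq_norm_sq_to_K, he]
    simp
  have horth : Orthonormal ℂ e := by
    refine ⟨he, fun p q hpq => ?_⟩
    change inner ℂ (e p) (e q) = 0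
    have h0 : π p.1 (π q.1 (e q)) = 0 := by
      rw [← ContinuousLinearMap.comp_apply, ← ContinuousLinearMap.mul_def, ← map_mul,
        MinimalProjection.mul_eq_zero hT.cartan.commutative hpq, map_zero]
      rfl
    rw [hself, hπ, rankOne_apply, smul_eq_zero] at h0
    refine h0.resolve_right fun h => ?_
    have := he p
    rw [h, norm_zero] at this
    exact zero_ne_one this
  have hbot : (Submodule.span ℂ (Set.range e))ᗮ = ⊥ := by
    refine (Submodule.eq_bot_iff _).2 fun ξ hξ => ?_
    have hξ' : ∀ p, inner ℂ (e p) ξ = (0 : ℂ) := fun p =>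
      (Submodule.mem_orthogonal _ ξ).1 hξ _ (Submodule.subset_span ⟨p, rfl⟩)
    obtain ⟨k, hk⟩ := hsurj _ (rankOne_mem_compactOperators ξ ξ)
    have hks : star k = k := hinj (by
      rw [map_star, hk]
      exact adjoint_rankOne _ _)
    have hpk : ∀ p : MinimalProjection B, p.1 * k = 0 := fun p => hinj (by
      rw [map_mul, hk, map_zero, hπ]
      refine ContinuousLinearMap.ext fun ζ => ?_
      change rankOne ℂ (e p) (e p) (rankOne ℂ ξ ξ ζ) = 0
      rw [rankOne_apply, rankOne_apply, inner_smul_right, hξ', mul_zero, zero_smul])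
    obtain ⟨E, hE⟩ := hT.cartan.expectation
    obtain ⟨I, ⟨φ⟩⟩ := hT.ellInfty
    -- Here `k` represents `|ξ⟩⟨ξ|` with `ξ` orthogonal to the family, so `p k = 0` for every `p`.
    -- By the bimodule property `p E(k* k) = E(p k* k p) = 0`, and the minimal projections separate
    -- the elements of `B`.
    have hEk : E (star k * k) = 0 := by
      refine eq_zero_of_forall_minimalProjection_mul φ (hE.map_mem _) fun p => ?_
      obtain ⟨c, h1, -⟩ := p.exists_mul_eq hT.cartan.commutative (hE.map_mem (star k * k))
      have h2 : p.1 * E (star k * k) * p.1 = p.1 * E (star k * k) := by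
        rw [h1, smul_mul_assoc, p.isIdempotentElem]
      rw [← h2, ← hE.bimodule _ _ p.2.1 _ p.2.1, hks, ← mul_assoc, hpk, zero_mul, zero_mul,
        map_zero]
    have hk0 := hE.faithful k hEk
    refine rankOne_self_apply_eq_zero ?_
    rw [← hk, hk0, map_zero]
    rfl
  refine ⟨(HilbertBasis.mkOfOrthogonalEqBot horth hbot).repr.symm, fun p => ?_⟩
  have hu : (HilbertBasis.mkOfOrthogonalEqBot horth hbot).repr.symm (delta p) = e p := by
    have := (HilbertBasis.mkOfOrthogonalEqBot horth hbot).repr_symm_single p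
    rw [HilbertBasis.coe_mkOfOrthogonalEqBot] at this
    rw [← this]
    congr 1
  rw [hu, hπ]

end Basis

/-! ### Normalisers as limits of weighted partial translations -/

section Translations

open InnerProductSpace

variable {X : Type u}

/-- If the normalising conjugate `T δ_y δ_y* T*` is diagonal for every `y`, then each column of `T`
has at most one nonzero entry. -/
theorem eq_of_matrixEntry_ne_zero {T : L2Op X}
    (h : ∀ y, T * rankOne ℂ (delta y) (delta y) * star T ∈ multiplicationOperators X) {x z y : X}
    (hx : matrixEntry T x y ≠ 0) (hz : matrixEntry T z y ≠ 0) : x = z := by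
  by_contra hxz
  have h1 := mem_multiplicationOperators_iff_matrixEntry.1 (h y) x z hxz
  have h2 : matrixEntry (T * rankOne ℂ (delta y) (delta y) * star T) x z
      = star (matrixEntry T z y) * matrixEntry T x y := by
    change inner ℂ (delta x) (T (rankOne ℂ (delta y) (delta y) (star T (delta z)))) = _
    rw [rankOne_apply, map_smul, inner_smul_right, ← matrixEntry_star]
    rfl
  rw [h2, mul_eq_zero, star_eq_zero] at h1
  exact h1.elim hz hx

theorem isPartialBijection_operatorSupport {T : L2Op X}
    (h : ∀ d ∈ multiplicationOperators X,
      T * d * star T ∈ multiplicationOperators X ∧ star T * d * T ∈ multiplicationOperators X) :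
    IsPartialBijection (operatorSupport T) := by
  refine ⟨fun x y z hy hz => ?_, fun x y z hx hy => ?_⟩
  · refine eq_of_matrixEntry_ne_zero (T := star T) (y := x) (fun t => ?_) ?_ ?_
    · rw [star_star]
      exact (h _ (rankOne_delta_self_mem t)).2
    · rw [matrixEntry_star, star_ne_zero]
      exact hy
    · rw [matrixEntry_star, star_ne_zero]
      exact hz
  · exact eq_of_matrixEntry_ne_zero (fun t => (h _ (rankOne_delta_self_mem t)).1) hx hy

/-- The part of the support of `T` where the entries have absolute value at least `ε`. -/
def largeSupport (T : L2Op X) (ε : ℝ) : SetRel X X := {p | ε ≤ ‖matrixEntry T p.1 p.2‖}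

theorem largeSupport_subset (T : L2Op X) {ε : ℝ} (hε : 0 < ε) :
    largeSupport T ε ⊆ operatorSupport T := fun p hp =>
  norm_pos_iff.1 (hε.trans_le (show ε ≤ ‖matrixEntry T p.1 p.2‖ from hp))

theorem IsPartialBijection.mono {R S : SetRel X X} (hS : IsPartialBijection S) (h : R ⊆ S) :
    IsPartialBijection R :=
  ⟨fun x y z hy hz => hS.1 x y z (h hy) (h hz), fun x y z hx hy => hS.2 x y z (h hx) (h hy)⟩

/-- Multiply each column by the inverse of its large entry; the cutoff bounds these inverses by
`ε⁻¹`. -/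
theorem exists_isPartialTranslation_largeSupport {T : L2Op X}
    (hT : IsPartialBijection (operatorSupport T)) {ε : ℝ} (hε : 0 < ε) :
    ∃ f : ℓ^∞(X, ℂ), IsPartialTranslation (largeSupport T ε) (T * diagOp f) := by
  classical
  refine ⟨boundedFun (fun y => if h : ∃ x, (x, y) ∈ largeSupport T ε then
    (matrixEntry T h.choose y)⁻¹ else 0) ε⁻¹ fun y => ?_, hT.mono (largeSupport_subset T hε),
    fun x y hxy => ?_, fun x y hxy => ?_⟩
  · split_ifs with h
    · rw [norm_inv]
      exact inv_anti₀ hε h.choose_spec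
    · rw [norm_zero]
      positivity
  · rw [matrixEntry_mul_diagOp]
    have h : ∃ x, (x, y) ∈ largeSupport T ε := ⟨x, hxy⟩
    change _ * dite _ _ _ = _
    rw [dif_pos h, hT.2 _ _ y (largeSupport_subset T hε h.choose_spec)
      (largeSupport_subset T hε hxy)]
    exact mul_inv_cancel₀ (largeSupport_subset T hε hxy)
  · rw [matrixEntry_mul_diagOp]
    change _ * dite _ _ _ = _
    split_ifs with h
    · refine mul_eq_zero_of_left ?_ _
      by_contra hne
      refine hxy ?_
      rw [hT.2 x _ y hne (largeSupport_subset T hε h.choose_spec)]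
      exact h.choose_spec
    · exact mul_zero _

theorem norm_le_of_mem_multiplicationOperators {T : L2Op X} (hT : T ∈ multiplicationOperators X)
    {C : ℝ} (hC : 0 ≤ C) (h : ∀ x, ‖matrixEntry T x x‖ ≤ C) : ‖T‖ ≤ C := by
  obtain ⟨f, rfl⟩ := mem_multiplicationOperators_iff.1 hT
  exact (norm_diagOp_le f).trans
    (lp.norm_le_of_forall_le hC fun x => by simpa only [matrixEntry_diagOp_self] using h x)

theorem one_mem_multiplicationOperators : (1 : L2Op X) ∈ multiplicationOperators X :=
  mem_multiplicationOperators_iff_matrixEntry.2 fun _ _ hxy => inner_delta_delta_ne hxy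

/-- The norm of an operator supported on the graph of a partial bijection is the supremum of its
entries. -/
theorem norm_le_of_operatorSupport_subset {T : L2Op X} (hT : IsPartialBijection (operatorSupport T))
    {ε : ℝ} (hε : 0 ≤ ε) (h : ∀ x y, ‖matrixEntry T x y‖ ≤ ε) : ‖T‖ ≤ ε := by
  have hmem : star T * T ∈ multiplicationOperators X := by
    have := star_mul_mul_mem_of_operatorSupport_subset hT subset_rfl
      (one_mem_multiplicationOperators (X := X))
    rwa [mul_one] at this
  have hcol : ∀ y, ‖T (delta y)‖ ≤ ε := by
    intro y
    by_cases hy : ∃ x, (x, y) ∈ operatorSupport T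
    · obtain ⟨x, hx⟩ := hy
      rw [apply_delta_eq_smul (x := x) fun z hz => ?_, norm_smul, norm_delta, mul_one]
      · exact h x y
      · by_contra hne
        exact hz (hT.2 z x y hne hx)
    · rw [show T (delta y) = 0 from lp.ext (funext fun x => ?_), norm_zero]
      · exact hε
      · rw [apply_delta_apply]
        by_contra hne
        exact hy ⟨x, hne⟩
  -- By the C⋆-identity it is enough to bound `T* T`, which is diagonal with entries `‖T δ_x‖ ^ 2`.
  refine (sq_le_sq₀ (norm_nonneg _) hε).1 ?_
  rw [sq, ← CStarRing.norm_star_mul_self]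
  refine norm_le_of_mem_multiplicationOperators hmem (by positivity) fun x => ?_
  rw [matrixEntry_star_mul_self, Complex.norm_real, norm_pow, norm_norm]
  exact pow_le_pow_left₀ (norm_nonneg _) (hcol x) 2

/-- An operator with at most one nonzero entry in each row and each column is the limit of its
truncations to large entries. -/
theorem mem_uniformRoeAlgebra_of_largeSupport {𝓔 : CoarseStructure X} {T : L2Op X}
    (hT : IsPartialBijection (operatorSupport T))
    (h : ∀ ε, 0 < ε → largeSupport T ε ∈ 𝓔.entourages) : T ∈ uniformRoeAlgebra 𝓔 := by
  classical
  change T ∈ closure (finitePropagation 𝓔 : Set (L2Op X))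
  refine Metric.mem_closure_iff.2 fun ε hε => ?_
  -- Cutting at `ε / 2` leaves a remainder of norm at most `ε / 2`, hence strictly less than `ε`.
  -- Columns have at most one nonzero entry, so the truncation is multiplication by an indicator
  -- function.
  set S := largeSupport T (ε / 2) with hS
  have hsupp : S ⊆ operatorSupport T := largeSupport_subset T (half_pos hε)
  set f : ℓ^∞(X, ℂ) := boundedFun (fun y => if ∃ x, (x, y) ∈ S then 1 else 0) 1 fun y => by
    split_ifs <;> simp
  have hmem : ∀ x y, (x, y) ∈ S → matrixEntry (T * diagOp f) x y = matrixEntry T x y := by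
    intro x y hxy
    rw [matrixEntry_mul_diagOp]
    change _ * ite _ _ _ = _
    rw [if_pos ⟨x, hxy⟩, mul_one]
  have hnot : ∀ x y, (x, y) ∉ S → matrixEntry (T * diagOp f) x y = 0 := by
    intro x y hxy
    rw [matrixEntry_mul_diagOp]
    change _ * ite _ _ _ = _
    split_ifs with hy
    · refine mul_eq_zero_of_left ?_ _
      by_contra hne
      obtain ⟨z, hz⟩ := hy
      exact hxy (hT.2 x z y hne (hsupp hz) ▸ hz)
    · exact mul_zero _
  refine ⟨T * diagOp f, 𝓔.subset_mem _ (h _ (half_pos hε)) _ fun p hp =>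
    not_not.1 fun hpS => hp (hnot _ _ hpS), ?_⟩
  rw [dist_eq_norm]
  refine lt_of_le_of_lt (norm_le_of_operatorSupport_subset (hT.mono fun p hp h0 => hp ?_)
    (half_pos hε).le fun x y => ?_) (half_lt_self hε)
  · rw [matrixEntry_sub, matrixEntry_mul_diagOp, h0, zero_mul, sub_zero]
  · rw [matrixEntry_sub]
    by_cases hxy : (x, y) ∈ S
    · rw [hmem x y hxy, sub_self, norm_zero]
      positivity
    · rw [hnot x y hxy, sub_zero]
      exact (not_le.1 hxy).le

/-- The coarse structure generated by the graphs of the partial translations in an algebra of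
operators. -/
def translationCoarseStructure (S : StarSubalgebra ℂ (L2Op X)) : CoarseStructure X where
  entourages := {E | ∃ 𝓡 : Set (SetRel X X), 𝓡.Finite ∧
    (∀ R ∈ 𝓡, ∃ v ∈ S, IsPartialTranslation R v) ∧ E ⊆ ⋃₀ 𝓡}
  union_mem := by
    rintro E ⟨𝓡, hf, h𝓡, hE⟩ F ⟨𝓢, hf', h𝓢, hF⟩
    refine ⟨𝓡 ∪ 𝓢, hf.union hf', ?_, ?_⟩
    · rintro R (hR | hR)
      exacts [h𝓡 R hR, h𝓢 R hR]
    · rw [Set.sUnion_union]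
      exact Set.union_subset_union hE hF
  comp_mem := by
    rintro E ⟨𝓡, hf, h𝓡, hE⟩ F ⟨𝓢, hf', h𝓢, hF⟩
    refine ⟨Set.image2 SetRel.comp 𝓡 𝓢, hf.image2 _ hf', ?_, ?_⟩
    · rintro _ ⟨R, hR, R', hR', rfl⟩
      obtain ⟨v, hv, hvR⟩ := h𝓡 R hR
      obtain ⟨v', hv', hvR'⟩ := h𝓢 R' hR'
      exact ⟨v * v', mul_mem hv hv', hvR.mul hvR'⟩
    · rintro ⟨x, z⟩ ⟨y, hxy, hyz⟩
      obtain ⟨R, hR, hxy⟩ := hE hxy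
      obtain ⟨R', hR', hyz⟩ := hF hyz
      exact ⟨_, ⟨R, hR, R', hR', rfl⟩, ⟨y, hxy, hyz⟩⟩
  inv_mem := by
    rintro E ⟨𝓡, hf, h𝓡, hE⟩
    refine ⟨SetRel.inv '' 𝓡, hf.image _, ?_, ?_⟩
    · rintro _ ⟨R, hR, rfl⟩
      obtain ⟨v, hv, hvR⟩ := h𝓡 R hR
      exact ⟨star v, star_mem hv, hvR.star⟩
    · rintro ⟨x, y⟩ hxy
      obtain ⟨R, hR, hyx⟩ := hE (show (y, x) ∈ E from hxy)
      exact ⟨_, ⟨R, hR, rfl⟩, hyx⟩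
  subset_mem := by
    rintro E ⟨𝓡, hf, h𝓡, hE⟩ F hF
    exact ⟨𝓡, hf, h𝓡, hF.trans hE⟩
  diagonal_mem := ⟨{SetRel.id}, Set.finite_singleton _,
    fun R hR => ⟨1, one_mem S, (Set.mem_singleton_iff.1 hR) ▸ isPartialTranslation_one⟩,
    (Set.sUnion_singleton _).ge⟩

/-- Each row or column meets the graph of a partial bijection at most once, so slices have at most
as many points as there are graphs. -/
theorem hasBoundedGeometry_translationCoarseStructure (S : StarSubalgebra ℂ (L2Op X)) :
    (translationCoarseStructure S).HasBoundedGeometry := by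
  rintro E ⟨𝓡, hf, h𝓡, hE⟩
  have hpb : ∀ R ∈ 𝓡, IsPartialBijection R := fun R hR =>
    let ⟨_, _, hv⟩ := h𝓡 R hR; hv.isPartialBijection
  -- Assign to every pair of `E` one graph containing it; this assignment is injective on each
  -- slice.
  choose! φ hφ using fun p (hp : p ∈ E) => hE hp
  refine ⟨𝓡.ncard, fun x => ?_⟩
  rw [hf.cast_ncard_eq]
  refine ⟨Set.encard_le_encard_of_injOn (f := fun y => φ (y, x)) (fun y hy => (hφ _ hy).1) ?_,
    Set.encard_le_encard_of_injOn (f := fun y => φ (x, y)) (fun y hy => (hφ _ hy).1) ?_⟩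
  · intro y hy z hz hyz
    have h1 := (hφ _ hy).2
    rw [show φ (y, x) = φ (z, x) from hyz] at h1
    exact (hpb _ (hφ _ hz).1).2 y z x h1 (hφ _ hz).2
  · intro y hy z hz hyz
    have h1 := (hφ _ hy).2
    rw [show φ (x, y) = φ (x, z) from hyz] at h1
    exact (hpb _ (hφ _ hz).1).1 x y z h1 (hφ _ hz).2

/-- Such an operator is a finite sum of products `v * diagOp f` with both factors in `S`. -/
theorem mem_of_operatorSupport_mem_translationCoarseStructure {S : StarSubalgebra ℂ (L2Op X)}
    (hS : ∀ T ∈ multiplicationOperators X, T ∈ S) {T : L2Op X}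
    (hT : operatorSupport T ∈ (translationCoarseStructure S).entourages) : T ∈ S := by
  obtain ⟨𝓡, hf, h𝓡, hE⟩ := hT
  refine mem_of_operatorSupport_subset_sUnion hf
    (fun R hR => let ⟨_, _, hv⟩ := h𝓡 R hR; hv.isPartialBijection)
    (Subalgebra.toSubmodule S.toSubalgebra).toAddSubmonoid (fun R hR T hT => ?_) T hE
  obtain ⟨v, hv, hvR⟩ := h𝓡 R hR
  obtain ⟨f, rfl⟩ := hvR.exists_eq_mul_diagOp hT
  exact S.mul_mem hv (hS _ (diagOp_mem f))

end Translations

/-! ### Reconstructing the Roe algebra from a Cartan triple -/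

section Reconstruction

open InnerProductSpace

variable {A : Type u} [CStarAlgebra A] {B K : NonUnitalStarSubalgebra ℂ A}

/-- `j` is a faithful representation of `A` on `ℓ²` of the minimal projections of `B`, which takes
`B` to the multiplication operators, `K` to the compact operators, and each minimal projection `p`
to the projection onto `ℂ δ_p`. -/
structure IsDiagonalRepresentation (B K : NonUnitalStarSubalgebra ℂ A)
    (j : A →⋆ₐ[ℂ] L2Op (MinimalProjection B)) : Prop where
  injective : Function.Injective j
  map_minimalProjection : ∀ p : MinimalProjection B, j p.1 = rankOne ℂ (delta p) (delta p)
  mem_left_iff : ∀ a, a ∈ B ↔ j a ∈ multiplicationOperators (MinimalProjection B)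
  exists_left : ∀ T ∈ multiplicationOperators (MinimalProjection B), ∃ a, j a = T
  mem_right_iff : ∀ a, a ∈ K ↔ j a ∈ compactOperators ℓ²(MinimalProjection B, ℂ)
  exists_right : ∀ T ∈ compactOperators ℓ²(MinimalProjection B, ℂ), ∃ a, j a = T

namespace IsDiagonalRepresentation

variable {j : A →⋆ₐ[ℂ] L2Op (MinimalProjection B)}

theorem norm_mul_mul (hj : IsDiagonalRepresentation B K j) (a : A) (p q : MinimalProjection B) :
    ‖p.1 * a * q.1‖ = ‖matrixEntry (j a) p q‖ := by
  rw [← NonUnitalStarAlgHom.norm_map j hj.injective, map_mul, map_mul, hj.map_minimalProjection,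
    hj.map_minimalProjection, norm_rankOne_mul_mul_rankOne]

theorem largeSupport_eq (hj : IsDiagonalRepresentation B K j) (a : A) (ε : ℝ) :
    largeSupport (j a) ε = {p | ε ≤ ‖p.1.1 * a * p.2.1‖} :=
  Set.ext fun p => by
    change ε ≤ _ ↔ ε ≤ _
    rw [hj.norm_mul_mul]

theorem mem_normaliser_iff (hj : IsDiagonalRepresentation B K j) (a : A) :
    a ∈ normaliser B ↔ ∀ d ∈ multiplicationOperators (MinimalProjection B),
      j a * d * star (j a) ∈ multiplicationOperators (MinimalProjection B) ∧
      star (j a) * d * j a ∈ multiplicationOperators (MinimalProjection B) := by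
  constructor
  · intro ha d hd
    obtain ⟨b, rfl⟩ := hj.exists_left d hd
    have := ha b ((hj.mem_left_iff b).2 hd)
    simpa only [hj.mem_left_iff, map_mul, map_star] using this
  · intro h b hb
    have := h _ ((hj.mem_left_iff b).1 hb)
    simpa only [hj.mem_left_iff, map_mul, map_star] using this

theorem isPartialBijection (hj : IsDiagonalRepresentation B K j) {a : A} (ha : a ∈ normaliser B) :
    IsPartialBijection (operatorSupport (j a)) :=
  isPartialBijection_operatorSupport ((hj.mem_normaliser_iff a).1 ha)

/-- A generator is the large support of `j a` for a normaliser `a`; the rescaling that turns it into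
a partial translation is diagonal and so belongs to `j B`. -/
theorem mem_translationCoarseStructure (hj : IsDiagonalRepresentation B K j)
    {E : SetRel (MinimalProjection B) (MinimalProjection B)}
    (hE : E ∈ (cartanCoarseStructure B).entourages) :
    E ∈ (translationCoarseStructure j.range).entourages := by
  refine hE _ ?_
  rintro _ ⟨a, ha, ε, hε, rfl⟩
  rw [← hj.largeSupport_eq]
  obtain ⟨f, hf⟩ := exists_isPartialTranslation_largeSupport (hj.isPartialBijection ha) hε
  refine ⟨{largeSupport (j a) ε}, Set.finite_singleton _, ?_, (Set.sUnion_singleton _).ge⟩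
  rintro R hR
  rw [Set.mem_singleton_iff.1 hR]
  obtain ⟨b, hb⟩ := hj.exists_left _ (diagOp_mem f)
  exact ⟨_, ⟨a * b, by
    change j (a * b) = _
    rw [map_mul, hb]⟩, hf⟩

theorem hasBoundedGeometry (hj : IsDiagonalRepresentation B K j) :
    (cartanCoarseStructure B).HasBoundedGeometry := fun E hE =>
  hasBoundedGeometry_translationCoarseStructure j.range E (hj.mem_translationCoarseStructure hE)

/-- The matrix unit at `(p, q)` is compact, hence comes from `A`, and it is a normaliser whose only
nonzero entry is 1. -/
theorem isConnected (hj : IsDiagonalRepresentation B K j) :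
    (cartanCoarseStructure B).IsConnected := by
  intro p q
  obtain ⟨k, hk⟩ := hj.exists_right _ (rankOne_mem_compactOperators (delta p) (delta q))
  have hsupp : operatorSupport (j k) ⊆ {(p, q)} := fun r hr => by
    by_contra h
    refine hr ?_
    rw [hk]
    exact rankOne_delta_delta_entry_of_ne p q h
  have hpb : IsPartialBijection ({(p, q)} : SetRel (MinimalProjection B) (MinimalProjection B)) :=
    ⟨fun x y z hy hz => (Prod.ext_iff.1 hy).2.trans (Prod.ext_iff.1 hz).2.symm,
      fun x y z hx hy => (Prod.ext_iff.1 hx).1.trans (Prod.ext_iff.1 hy).1.symm⟩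
  have hkN : k ∈ normaliser B := (hj.mem_normaliser_iff k).2 fun d hd =>
    ⟨mul_mul_star_mem_of_operatorSupport_subset hpb hsupp hd,
      star_mul_mul_mem_of_operatorSupport_subset hpb hsupp hd⟩
  have hmem : {r : MinimalProjection B × MinimalProjection B | 1 ≤ ‖r.1.1 * k * r.2.1‖} ∈
      (cartanCoarseStructure B).entourages :=
    CoarseStructure.mem_generate ⟨k, hkN, 1, one_pos, rfl⟩
  refine CoarseStructure.subset_mem _ _ hmem _ ?_
  rintro _ rfl
  change 1 ≤ ‖p.1 * k * q.1‖
  rw [hj.norm_mul_mul, hk, matrixEntry, rankOne_apply, inner_smul_right, inner_delta_left,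
    inner_delta_left, delta_apply_self, delta_apply_self, mul_one, norm_one]

/-- Operators of finite propagation are finite sums of partial translations in `j A` times
multiplication operators, and `j A` is closed; this gives one inclusion. Conversely each normaliser
is the limit of its truncations to generators of `𝓔_A`, and the normalisers generate `A`. -/
theorem isRoeRepresentation (hj : IsDiagonalRepresentation B K j)
    (hgen : (NonUnitalStarAlgebra.adjoin ℂ (normaliser B)).topologicalClosure = ⊤) :
    IsRoeRepresentation (cartanCoarseStructure B) B K j where
  injective := hj.injective
  mem_left_iff := hj.mem_left_iff
  mem_right_iff := hj.mem_right_iff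
  mem_range_iff T := by
    have hiso : Isometry j := NonUnitalStarAlgHom.isometry j hj.injective
    constructor
    · intro hT
      have hcl : IsClosed (Set.range j) := hiso.isClosedEmbedding.isClosed_range
      refine hcl.closure_subset_iff.2 ?_
        (show T ∈ closure (finitePropagation (cartanCoarseStructure B) : Set _) from hT)
      intro S hS
      exact mem_of_operatorSupport_mem_translationCoarseStructure (S := j.range)
        hj.exists_left (hj.mem_translationCoarseStructure hS)
    · rintro ⟨a, rfl⟩
      have hcl : IsClosed (j ⁻¹' (uniformRoeAlgebra (cartanCoarseStructure B) : Set _)) :=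
        (uniformRoeAlgebra_isClosed _).preimage hiso.continuous
      have hle : NonUnitalStarAlgebra.adjoin ℂ (normaliser B) ≤
          ((uniformRoeAlgebra (cartanCoarseStructure B)).comap j).toNonUnitalStarSubalgebra := by
        refine NonUnitalStarAlgebra.adjoin_le fun a ha => ?_
        refine mem_uniformRoeAlgebra_of_largeSupport (hj.isPartialBijection ha) fun ε hε => ?_
        exact CoarseStructure.mem_generate ⟨a, ha, ε, hε, hj.largeSupport_eq a ε⟩
      have ha : a ∈ (NonUnitalStarAlgebra.adjoin ℂ (normaliser B)).topologicalClosure := by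
        rw [hgen]
        trivial
      exact hcl.closure_subset_iff.2 hle ha

end IsDiagonalRepresentation

end Reconstruction

/-! ### Diagonal representations and the main theorem -/

section Main

open InnerProductSpace

theorem conjByUnitary_rankOne {X : Type u} {H : Type w} [NormedAddCommGroup H]
    [InnerProductSpace ℂ H] (v : ℓ²(X, ℂ) ≃ₗᵢ[ℂ] H) (x : X) :
    conjByUnitary v (rankOne ℂ (v (delta x)) (v (delta x))) = rankOne ℂ (delta x) (delta x) := by
  ext1 ξ
  change v.symm (rankOne ℂ (v (delta x)) (v (delta x)) (v ξ)) = _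
  rw [rankOne_apply, rankOne_apply, v.inner_map_map, map_smul, v.symm_apply_apply]

variable {A : Type u} [CStarAlgebra A] {B K : NonUnitalStarSubalgebra ℂ A}
  {H : Type w} [NormedAddCommGroup H] [InnerProductSpace ℂ H] [CompleteSpace H]

theorem exists_isDiagonalRepresentation (hT : IsCartanTriple B K)
    {π : A →⋆ₐ[ℂ] (H →L[ℂ] H)} (hinj : Function.Injective π)
    (hmem : ∀ k ∈ K, π k ∈ compactOperators H)
    (hsurj : ∀ T ∈ compactOperators H, ∃ k ∈ K, π k = T) :
    ∃ (v : ℓ²(MinimalProjection B, ℂ) ≃ₗᵢ[ℂ] H)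
      (j : A →⋆ₐ[ℂ] L2Op (MinimalProjection B)), (∀ a, j a = conjByUnitary v (π a)) ∧
      IsDiagonalRepresentation B K j := by
  obtain ⟨v, hv⟩ := exists_unitary_of_isCartanTriple hT hinj fun T hT' =>
    (hsurj T hT').imp fun _ h => h.2
  let V : ℓ²(MinimalProjection B, ℂ) →L[ℂ] H := v.toContinuousLinearEquiv
  let W : H →L[ℂ] ℓ²(MinimalProjection B, ℂ) := v.symm.toContinuousLinearEquiv
  have hVW : ∀ S : H →L[ℂ] H, V ∘L (W ∘L S ∘L V) ∘L W = S := fun S => by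
    ext ξ
    change v (v.symm (S (v (v.symm ξ)))) = S ξ
    rw [v.apply_symm_apply, v.apply_symm_apply]
  have hWV : ∀ S : L2Op (MinimalProjection B), W ∘L (V ∘L S ∘L W) ∘L V = S := fun S => by
    ext1 ξ
    change v.symm (v (S (v.symm (v ξ)))) = S ξ
    rw [v.symm_apply_apply, v.symm_apply_apply]
  let j : A →⋆ₐ[ℂ] L2Op (MinimalProjection B) :=
    v.symm.conjStarAlgEquiv.toStarAlgHom.comp π
  have hj : ∀ a, j a = W ∘L π a ∘L V := fun a => rfl
  have hjinj : Function.Injective j := fun a b hab => hinj (by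
    rw [hj, hj] at hab
    rw [← hVW (π a), hab, hVW])
  have hjp : ∀ p : MinimalProjection B, j p.1 = rankOne ℂ (delta p) (delta p) := fun p => by
    rw [hj, hv]
    exact conjByUnitary_rankOne v p
  obtain ⟨I, ⟨φ⟩⟩ := hT.ellInfty
  -- Commutativity of `B` is enough here: commuting with every projection onto `ℂ δ_p` means being
  -- diagonal.
  have hleft : ∀ b ∈ B, j b ∈ multiplicationOperators (MinimalProjection B) := by
    intro b hb
    refine mem_multiplicationOperators_of_commute fun p => ?_
    rw [← hjp, ← map_mul, ← map_mul, hT.cartan.commutative b hb p.1 p.2.1]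
  -- For the converse, the isomorphism of `B` with `ℓ^∞(I)` provides an element with prescribed
  -- bounded scalars on all minimal projections.
  have hleft' : ∀ f : ℓ^∞(MinimalProjection B, ℂ), ∃ b ∈ B, j b = diagOp f := by
    intro f
    obtain ⟨b, hb, hbf⟩ := exists_mem_forall_minimalProjection_mul_eq hT.cartan.commutative φ f
    refine ⟨b, hb, eq_of_mem_multiplicationOperators (hleft b hb) (diagOp_mem f) fun p => ?_⟩
    rw [matrixEntry_diagOp_self]
    have h := congrArg (fun a => matrixEntry (j a) p p) (hbf p)
    obtain ⟨g, hg⟩ := mem_multiplicationOperators_iff.1 (hleft b hb)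
    simp only [map_mul, map_smul, hjp, hg, rankOne_mul_diagOp] at h
    rw [hg, matrixEntry_diagOp_self]
    have h1 : matrixEntry (rankOne ℂ (delta p) (delta p)) p p = 1 := by
      rw [matrixEntry, rankOne_apply, inner_smul_right, inner_delta_left, delta_apply_self, mul_one]
    have h2 : ∀ c : ℂ, matrixEntry (c • rankOne ℂ (delta p) (delta p)) p p = c := fun c =>
      (inner_smul_right _ _ _).trans ((congrArg (c * ·) h1).trans (mul_one c))
    rwa [h2, h2] at h
  refine ⟨v, j, hj, hjinj, hjp, fun a => ⟨hleft a, fun ha => ?_⟩, fun T hT' => ?_,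
    fun a => ⟨fun ha => ?_, fun ha => ?_⟩, fun T hT' => ?_⟩
  · obtain ⟨f, hf⟩ := mem_multiplicationOperators_iff.1 ha
    obtain ⟨b, hb, hbf⟩ := hleft' f
    rwa [hjinj (hf.trans hbf.symm)]
  · obtain ⟨f, rfl⟩ := mem_multiplicationOperators_iff.1 hT'
    obtain ⟨b, -, hbf⟩ := hleft' f
    exact ⟨b, hbf⟩
  · exact (IsCompactOperator.comp_clm (hmem a ha) V).clm_comp W
  · have h : V ∘L j a ∘L W ∈ compactOperators H := (IsCompactOperator.comp_clm ha W).clm_comp V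
    rw [hj, hVW] at h
    obtain ⟨k, hk, hka⟩ := hsurj _ h
    rwa [← hinj hka]
  · obtain ⟨k, -, hk⟩ := hsurj (V ∘L T ∘L W) ((IsCompactOperator.comp_clm hT' W).clm_comp V)
    exact ⟨k, by rw [hj, hk, hWV]⟩

theorem exists_isIrreducibleRep (hT : IsCartanTriple B K) :
    ∃ (H : Type u) (_ : NormedAddCommGroup H) (_ : InnerProductSpace ℂ H) (_ : CompleteSpace H)
      (π₀ : K →⋆ₙₐ[ℂ] (H →L[ℂ] H)), Function.Injective π₀ ∧ IsIrreducibleRep π₀ := by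
  obtain ⟨H, i1, i2, i3, ⟨φ⟩⟩ := hT.compacts
  exact ⟨H, i1, i2, i3,
    (NonUnitalStarSubalgebraClass.subtype (compactOperators H)).comp φ.toNonUnitalStarAlgHom,
    Subtype.val_injective.comp (EquivLike.injective φ), isIrreducibleRep_of_equiv φ _ fun _ => rfl⟩

/-- The assertion does not mention a representation, so any faithful irreducible one of `K` may be
used to realise the triple on `ℓ²(X_B)`. -/
theorem IsCartanTriple.isConnected_and_hasBoundedGeometry (hT : IsCartanTriple B K) :
    (cartanCoarseStructure B).IsConnected ∧ (cartanCoarseStructure B).HasBoundedGeometry := by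
  obtain ⟨H, i1, i2, i3, π₀, hinj, hirr⟩ := exists_isIrreducibleRep hT
  obtain ⟨H₀, i1', i2', i3', ⟨φ⟩⟩ := hT.compacts
  obtain ⟨hmem, hsurj⟩ := hirr.isCompactOperator_and_surjective hinj φ
  obtain ⟨π, hπ⟩ := exists_extension hT.essentialIdeal hinj hsurj
  obtain ⟨v, j, -, hj⟩ := exists_isDiagonalRepresentation hT
    (extension_injective hT.essentialIdeal hinj hπ) (fun k hk => hπ ⟨k, hk⟩ ▸ hmem ⟨k, hk⟩)
    (fun T hT' => let ⟨k, hk⟩ := hsurj T hT'; ⟨k, k.2, (hπ k).trans hk⟩)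
  exact ⟨hj.isConnected, hj.hasBoundedGeometry⟩

end Main

theorem mainTheorem7 :
    -- `Φ` is well defined
    (∀ (X : Type u) (𝓔 : CoarseStructure X), 𝓔.IsConnected → 𝓔.HasBoundedGeometry →
      (∀ T ∈ multiplicationOperators X, T ∈ uniformRoeAlgebra 𝓔) ∧
      (∀ T ∈ compactOperators ℓ²(X, ℂ), T ∈ uniformRoeAlgebra 𝓔) ∧
      IsCartanTriple (ellInftyInRoe 𝓔) (compactsInRoe 𝓔)) ∧
    -- `Ψ` is well defined
    (∀ (A : Type u) [CStarAlgebra A] (B K : NonUnitalStarSubalgebra ℂ A), IsCartanTriple B K →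
      (cartanCoarseStructure B).IsConnected ∧ (cartanCoarseStructure B).HasBoundedGeometry) ∧
    -- `Φ ∘ Ψ` is isomorphic to the identity: `K` has a faithful irreducible representation, and
    -- any such representation `π₀` extends uniquely to a representation `π` of `A`, which is
    -- spatially equivalent to the uniform Roe algebra
    (∀ (A : Type u) [CStarAlgebra A] (B K : NonUnitalStarSubalgebra ℂ A), IsCartanTriple B K →
      (∃ (H : Type u) (_ : NormedAddCommGroup H) (_ : InnerProductSpace ℂ H)
        (_ : CompleteSpace H) (π₀ : K →⋆ₙₐ[ℂ] (H →L[ℂ] H)),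
        Function.Injective π₀ ∧ IsIrreducibleRep π₀) ∧
      (∀ (H : Type w) [NormedAddCommGroup H] [InnerProductSpace ℂ H] [CompleteSpace H]
        (π₀ : K →⋆ₙₐ[ℂ] (H →L[ℂ] H)), Function.Injective π₀ → IsIrreducibleRep π₀ →
        (∃! π : A →⋆ₐ[ℂ] (H →L[ℂ] H), ∀ k : K, π (k : A) = π₀ k) ∧
        (∀ π : A →⋆ₐ[ℂ] (H →L[ℂ] H), (∀ k : K, π (k : A) = π₀ k) →
          Function.Injective π ∧
          ∃ u : ℓ²(MinimalProjection B, ℂ) ≃ₗᵢ[ℂ] H,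
            (fun a : A => conjByUnitary u (π a)) '' Set.univ =
              (uniformRoeAlgebra (cartanCoarseStructure B) : Set _) ∧
            (fun a : A => conjByUnitary u (π a)) '' B =
              (multiplicationOperators (MinimalProjection B) : Set _) ∧
            (fun a : A => conjByUnitary u (π a)) '' K =
              (compactOperators ℓ²(MinimalProjection B, ℂ) : Set _)))) ∧
    -- `Ψ ∘ Φ` is isomorphic to the identity: under the identification `e` of `X` with the set of
    -- minimal projections of `ℓ^∞(X)`, which sends `x` to the projection onto `ℂ δ_x`, the
    -- coarse structures agree
    (∀ (X : Type u) (𝓔 : CoarseStructure X), 𝓔.IsConnected → 𝓔.HasBoundedGeometry →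
      ∃ e : X ≃ MinimalProjection (ellInftyInRoe 𝓔),
        (∀ (x : X) (ξ : ℓ²(X, ℂ)), (e x).1.1 ξ = inner ℂ (delta x) ξ • delta x) ∧
        ∀ E : SetRel X X, E ∈ 𝓔.entourages ↔
          Prod.map e e '' E ∈ (cartanCoarseStructure (ellInftyInRoe 𝓔)).entourages) := by
  refine ⟨fun X 𝓔 h h' => ⟨fun T hT => mem_uniformRoeAlgebra_of_mem_multiplicationOperators hT,
      fun T hT => mem_uniformRoeAlgebra_of_mem_compactOperators h hT, isCartanTriple_roe h h'⟩,
    fun A _ B K hT => hT.isConnected_and_hasBoundedGeometry,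
    fun A _ B K hT => ⟨exists_isIrreducibleRep hT, fun H _ _ _ π₀ hinj hirr => ?_⟩,
    fun X 𝓔 h h' => ?_⟩
  · obtain ⟨H₀, _, _, _, ⟨φ⟩⟩ := hT.compacts
    obtain ⟨hmem, hsurj⟩ := hirr.isCompactOperator_and_surjective hinj φ
    refine ⟨?_, fun π hπ => ⟨extension_injective hT.essentialIdeal hinj hπ, ?_⟩⟩
    · obtain ⟨π, hπ⟩ := exists_extension hT.essentialIdeal hinj hsurj
      exact ⟨π, hπ, fun π' hπ' => extension_unique hT.essentialIdeal hsurj hπ' hπ⟩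
    · obtain ⟨v, j, hjv, hj⟩ := exists_isDiagonalRepresentation hT
        (extension_injective hT.essentialIdeal hinj hπ) (fun k hk => hπ ⟨k, hk⟩ ▸ hmem ⟨k, hk⟩)
        (fun T hT' => let ⟨k, hk⟩ := hsurj T hT'; ⟨k, k.2, (hπ k).trans hk⟩)
      have hr := hj.isRoeRepresentation hT.cartan.generates
      refine ⟨v, ?_⟩
      rw [show (fun a : A => conjByUnitary v (π a)) = j from funext fun a => (hjv a).symm]
      refine ⟨Set.ext fun T => ?_, Set.ext fun T => ⟨?_, fun hT' => ?_⟩,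
        Set.ext fun T => ⟨?_, fun hT' => ?_⟩⟩
      · rw [Set.image_univ]
        exact (hr.mem_range_iff T).symm
      · rintro ⟨a, ha, rfl⟩
        exact (hj.mem_left_iff a).1 ha
      · obtain ⟨a, rfl⟩ := hj.exists_left T hT'
        exact ⟨a, (hj.mem_left_iff a).2 hT', rfl⟩
      · rintro ⟨a, ha, rfl⟩
        exact (hj.mem_right_iff a).1 ha
      · obtain ⟨a, rfl⟩ := hj.exists_right T hT'
        exact ⟨a, (hj.mem_right_iff a).2 hT', rfl⟩
  · have hr := isRoeRepresentation_subtype 𝓔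
    obtain ⟨e, he⟩ := hr.exists_equiv_minimalProjection
    exact ⟨e, fun x ξ => congrArg (fun S : L2Op X => S ξ) (he x), hr.mem_entourages_iff h' he⟩
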